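/- **Setting.** A conjunctive query with arithmetic comparisons (CQAC) $Q$ consists of a head (a tuple of terms), finitely many relational subgoals, and a finite set $\beta$ of arithmetic comparisons (ACs) $X\,\theta\,Y$ with $\theta\in\{<,\le,>,\ge,=,\ne\}$, $X$ a variable and $Y$ a variable or a constant. Values are taken from a dense linear order without endpoints that contains the rationals (e.g. $\mathbb Q$ or $\mathbb R$); constants are rational numbers, encoded in binary. Queries are safe (all variables of the head and of the ACs occur in relational subgoals), and the ACs of each query are consistent. $Q_2\sqsubseteq Q_1$ means $Q_2(D)\subseteq Q_1(D)$ for every finite database $D$. An LSI is an AC $X\le c$ (closed) or $X<c$ (open), an RSI is an AC $X\ge c$ (closed) or $X>c$ (open), with $c$ a constant. The closure of a set of ACs is the set of all ACs that it implies. We say that $X$ and $c$ are related by the closed LSI $X\le c$ in $Q_2$ if $X\le c$ is in the closure of the ACs of $Q_2$ while $X<c$ and $X=c$ are not, and likewise for the closed RSI $X\ge c$. The normalized form of $Q$ contains no equation introduced by normalization if the terms in the head and the relational subgoals of $Q$ are pairwise distinct variables (no repeated variable, no constant). **Theorem.** Let $Q_2$ range over all CQACs (with any ACs), and let $Q_1$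 range over the CQACs all of whose ACs are of one of the following types: 1. closed LSIs and at most one closed RSI; 2. closed LSIs and at most one open RSI; 3. open LSIs and at most one closed RSI; 4. open LSIs and at most one open RSI. Suppose that the pair $(Q_1,Q_2)$ satisfies the following conditions. (a) For any AC $X\neq Y$ of $Q_2$ between two variables and any constant $c_0$: either $c_0$ is not related to both $X$ and $Y$ by closed semi-interval ACs (LSI or RSI) in $Q_2$, or $c_0$ does not appear in an open AC of $Q_1$. (b) If $Q_2$ has an AC $X\ne Y$ between two variables, then no constant appears both in an open LSI and in an open RSI of $Q_1$ (automatic in cases 1–3). (c) If the normalization of $Q_1$ introduces an equation, then no constant of an open LSI of $Q_1$ appears in an open RSI of $Q_1$, or relates to a variable by a closed LSI in $Q_2$ (automatic in cases 1 and 2). Then, in each of the four cases, the following problem is in NP: given such a pair $(Q_1,Q_2)$, determine whether $Q_2\sqsubseteq Q_1$. That is, there is a language in NP that contains the encoding of such a pair if and only if $Q_2\sqsubseteq Q_1$. -/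

import Mathlib

/-! ### A cost-counting machine model and the class NP -/

namespace Machine

/-- Machine data: binary trees whose leaves are integers (written in binary). -/
inductive Data where
  | int (n : ℤ) : Data
  | pair (a b : Data) : Data
  deriving DecidableEq

/-- The size of a datum: number of nodes plus the total bit length of the leaves. -/
def Data.size : Data → ℕ
  | .int n => 1 + n.natAbs.size
  | .pair a b => 1 + a.size + b.size

/-- Elementary operations. -/
inductive Prim where
  | id | fst | snd | isPair | eq | le | add | sub | mul

/-- The result of an elementary operation.  Truth values are `0` (false) and `1` (true); an
operation that is applied to a datum of the wrong shape returns `0`. -/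
def Prim.eval : Prim → Data → Data
  | .id, x => x
  | .fst, .pair a _ => a
  | .snd, .pair _ b => b
  | .isPair, .pair _ _ => .int 1
  | .eq, .pair a b => if a = b then .int 1 else .int 0
  | .le, .pair (.int m) (.int n) => if m ≤ n then .int 1 else .int 0
  | .add, .pair (.int m) (.int n) => .int (m + n)
  | .sub, .pair (.int m) (.int n) => .int (m - n)
  | .mul, .pair (.int m) (.int n) => .int (m * n)
  | _, _ => .int 0

/-- Programs: elementary operations, constants, pairing of two results, sequential composition
(`comp g f` runs `f`, then `g`), branching, and while loops (`loop c f` repeats `f` as long as the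
test `c` returns something other than `0`). -/
inductive Prog where
  | prim (o : Prim) : Prog
  | const (d : Data) : Prog
  | pair (f g : Prog) : Prog
  | comp (g f : Prog) : Prog
  | ite (c f g : Prog) : Prog
  | loop (c f : Prog) : Prog

/-- `Runs p x y t`: on input `x` the program `p` halts with output `y` after time `t`.  Every step
is charged for the size of all data that it reads, copies or writes (logarithmic cost), so that
this notion of time is polynomially equivalent to the running time of Turing machines. -/
inductive Runs : Prog → Data → Data → ℕ → Prop where
  | prim (o : Prim) (x : Data) :
      Runs (.prim o) x (o.eval x) (1 + x.size + (o.eval x).size)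
  | const (d x : Data) :
      Runs (.const d) x d (1 + d.size)
  | pair {f g : Prog} {x y z : Data} {s t : ℕ} :
      Runs f x y s → Runs g x z t →
      Runs (.pair f g) x (.pair y z) (s + t + 1 + x.size + y.size + z.size)
  | comp {f g : Prog} {x y z : Data} {s t : ℕ} :
      Runs f x y s → Runs g y z t →
      Runs (.comp g f) x z (s + t + 1)
  | iteTrue {c f g : Prog} {x b y : Data} {s t : ℕ} :
      Runs c x b s → b ≠ .int 0 → Runs f x y t →
      Runs (.ite c f g) x y (s + t + 1 + x.size)
  | iteFalse {c f g : Prog} {x y : Data} {s t : ℕ} :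
      Runs c x (.int 0) s → Runs g x y t →
      Runs (.ite c f g) x y (s + t + 1 + x.size)
  | loopStop {c f : Prog} {x : Data} {s : ℕ} :
      Runs c x (.int 0) s →
      Runs (.loop c f) x x (s + 1 + x.size)
  | loopStep {c f : Prog} {x b y z : Data} {s t u : ℕ} :
      Runs c x b s → b ≠ .int 0 → Runs f x y t → Runs (.loop c f) y z u →
      Runs (.loop c f) x z (s + t + u + 1 + x.size)

/-- The class NP of languages: there are a verifier `V`, a polynomial bound `p` on the length of
certificates and a polynomial bound `q` on the running time, such that `V` halts within time
`q` on every input with every certificate of admissible length, and `x` belongs to the language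
iff `V` returns `1` on `x` with some certificate of admissible length. -/
def NP (L : Set Data) : Prop :=
  ∃ (V : Prog) (p q : Polynomial ℕ),
    (∀ x y : Data, y.size ≤ p.eval x.size →
      ∃ r t, Runs V (.pair x y) r t ∧ t ≤ q.eval x.size) ∧
    ∀ x : Data, x ∈ L ↔
      ∃ y : Data, y.size ≤ p.eval x.size ∧ ∃ t, Runs V (.pair x y) (.int 1) t

/-- A decision problem: a set of instances, presented to the machine through an encoding, and the
set of yes-instances. -/
structure DecisionProblem where
  Inst : Type
  enc : Inst → Data
  yes : Inst → Prop

/-- A decision problem is in NP if some language in NP gives the right answer on every instance. -/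
def DecisionProblem.InNP (P : DecisionProblem) : Prop :=
  ∃ L : Set Data, NP L ∧ ∀ I : P.Inst, P.enc I ∈ L ↔ P.yes I

end Machine

/-! ### Conjunctive queries with arithmetic comparisons -/

namespace CQAC

open Machine (Data DecisionProblem)

/-- Terms: variables (named by natural numbers) and constants (rational numbers). -/
inductive Term where
  | var (n : ℕ) : Term
  | const (c : ℚ) : Term

/-- A relational atom.  A relation is identified by its name together with its arity. -/
structure Atom where
  rel : ℕ
  args : List Term

/-- The comparison symbols `<`, `≤`, `>`, `≥`, `=`, `≠`. -/
inductive CompOp where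
  | lt | le | gt | ge | eq | ne

/-- An arithmetic comparison (AC) `X θ Y`: `X` is a variable, `Y` a variable or a constant. -/
structure AC where
  lhs : ℕ
  op : CompOp
  rhs : Term

/-- A conjunctive query with arithmetic comparisons: the terms of the head, the relational
subgoals, and the arithmetic comparisons. -/
structure Query where
  head : List Term
  body : List Atom
  acs : List AC

section Semantics

variable {D : Type*} [LinearOrder D] (ι : ℚ ↪o D)

/-- The value of a term under an assignment of the variables; `ι` interprets the constants. -/
def Term.eval (v : ℕ → D) : Term → D
  | .var n => v n
  | .const c => ι c

/-- The order relation denoted by a comparison symbol. -/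
def CompOp.Rel : CompOp → D → D → Prop
  | .lt, a, b => a < b
  | .le, a, b => a ≤ b
  | .gt, a, b => a > b
  | .ge, a, b => a ≥ b
  | .eq, a, b => a = b
  | .ne, a, b => a ≠ b

/-- Truth of an arithmetic comparison under an assignment. -/
def AC.Holds (v : ℕ → D) (a : AC) : Prop :=
  a.op.Rel (v a.lhs) (a.rhs.eval ι v)

/-- A fact over the domain `D`: a relation name and a tuple of values. -/
abbrev Fact (D : Type*) := ℕ × List D

/-- The fact that an assignment makes of a relational atom. -/
def Atom.fact (v : ℕ → D) (a : Atom) : Fact D :=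
  (a.rel, a.args.map (Term.eval ι v))

/-- The answer `Q(db)`: the head tuples of all assignments that map the relational subgoals into
the database and make the comparisons true. -/
def Query.answer (Q : Query) (db : Set (Fact D)) : Set (List D) :=
  {t | ∃ v : ℕ → D, (∀ a ∈ Q.body, a.fact ι v ∈ db) ∧ (∀ a ∈ Q.acs, a.Holds ι v) ∧
    t = Q.head.map (Term.eval ι v)}

/-- Containment `Q ⊑ Q'`: on every (finite) database, every answer to `Q` is an answer to `Q'`. -/
def Query.Contained (Q Q' : Query) : Prop :=
  ∀ db : Set (Fact D), db.Finite → Q.answer ι db ⊆ Q'.answer ι db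

/-- The variable `n` occurs in a relational subgoal of `Q`. -/
def Query.OccursInBody (Q : Query) (n : ℕ) : Prop :=
  ∃ a ∈ Q.body, Term.var n ∈ a.args

/-- The standing assumptions on a query: it is safe (head variables occur in relational subgoals),
its comparisons are safe (their variables occur in relational subgoals), and its comparisons are
consistent. -/
structure Query.WellFormed (Q : Query) : Prop where
  head_safe : ∀ n, Term.var n ∈ Q.head → Q.OccursInBody n
  lhs_safe : ∀ a ∈ Q.acs, Q.OccursInBody a.lhs
  rhs_safe : ∀ a ∈ Q.acs, ∀ n, a.rhs = .var n → Q.OccursInBody n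
  consistent : ∃ v : ℕ → D, ∀ a ∈ Q.acs, a.Holds ι v

/-- The set of comparisons `β` implies the comparison `a`, i.e. `a` is in the closure of `β`. -/
def Implies (β : List AC) (a : AC) : Prop :=
  ∀ v : ℕ → D, (∀ b ∈ β, b.Holds ι v) → a.Holds ι v

/-- The closure of `β` relates `X` to the constant `c` by the closed LSI `X ≤ c`, this being the
strongest comparison between `X` and `c`: neither `X < c` nor `X = c` is in the closure. -/
def ClosedLSI (β : List AC) (X : ℕ) (c : ℚ) : Prop :=
  Implies ι β ⟨X, .le, .const c⟩ ∧ ¬ Implies ι β ⟨X, .lt, .const c⟩ ∧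
    ¬ Implies ι β ⟨X, .eq, .const c⟩

/-- Likewise for the closed RSI `X ≥ c`. -/
def ClosedRSI (β : List AC) (X : ℕ) (c : ℚ) : Prop :=
  Implies ι β ⟨X, .ge, .const c⟩ ∧ ¬ Implies ι β ⟨X, .gt, .const c⟩ ∧
    ¬ Implies ι β ⟨X, .eq, .const c⟩

/-- The closure of `β` relates `X` to the constant `c` by a closed semi-interval comparison. -/
def ClosedRelated (β : List AC) (X : ℕ) (c : ℚ) : Prop :=
  ClosedLSI ι β X c ∨ ClosedRSI ι β X c

end Semantics

/-- `c` appears in an open LSI `X < c` of `Q`. -/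
def Query.OpenLSIConst (Q : Query) (c : ℚ) : Prop :=
  ∃ X, (⟨X, .lt, .const c⟩ : AC) ∈ Q.acs

/-- `c` appears in an open RSI `X > c` of `Q`. -/
def Query.OpenRSIConst (Q : Query) (c : ℚ) : Prop :=
  ∃ X, (⟨X, .gt, .const c⟩ : AC) ∈ Q.acs

/-- All comparisons of `Q` are of the form `X θ c` with `c` a constant and `θ` one of the two
symbols `l`, `r`, and at most one comparison with the symbol `r` is present. -/
def Query.InClass (l r : CompOp) (Q : Query) : Prop :=
  (∀ a ∈ Q.acs, (a.op = l ∨ a.op = r) ∧ ∃ c : ℚ, a.rhs = .const c) ∧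
  ∀ a ∈ Q.acs, ∀ b ∈ Q.acs, a.op = r → b.op = r → a = b

/-- The normalized form of `Q` introduces no equation: the terms in the head and the relational
subgoals of `Q` are pairwise distinct variables. -/
def Query.EquationFree (Q : Query) : Prop :=
  ∃ xs : List ℕ, xs.Nodup ∧ Q.head ++ Q.body.flatMap Atom.args = xs.map Term.var

/-- The condition on `≠` and shared constants, for the containing query `Q₁` and the contained
query `Q₂`. -/
structure SideCondition {D : Type*} [LinearOrder D] (ι : ℚ ↪o D) (Q₁ Q₂ : Query) : Prop where
  /-- For any `X ≠ Y` in `Q₂`, a constant of an open comparison of `Q₁` is not related to both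
  `X` and `Y` by closed comparisons. -/
  ne_closed : ∀ X Y : ℕ, (⟨X, .ne, .var Y⟩ : AC) ∈ Q₂.acs →
    ∀ c : ℚ, (Q₁.OpenLSIConst c ∨ Q₁.OpenRSIConst c) →
      ¬ (ClosedRelated ι Q₂.acs X c ∧ ClosedRelated ι Q₂.acs Y c)
  /-- If some `X ≠ Y` occurs in `Q₂`, no constant is shared by an open LSI and an open RSI
  of `Q₁`. -/
  ne_shared : ∀ X Y : ℕ, (⟨X, .ne, .var Y⟩ : AC) ∈ Q₂.acs →
    ∀ c : ℚ, Q₁.OpenLSIConst c → ¬ Q₁.OpenRSIConst c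
  /-- If the normalized form of `Q₁` contains equations, then no constant of an open LSI of `Q₁`
  appears in an open RSI of `Q₁` or in a closed LSI of (the closure of) `Q₂`. -/
  normalization : ¬ Q₁.EquationFree →
    ∀ c : ℚ, Q₁.OpenLSIConst c →
      ¬ Q₁.OpenRSIConst c ∧ ∀ X : ℕ, ¬ ClosedLSI ι Q₂.acs X c

/-! ### Encoding of queries as machine data -/

/-- Lists are encoded as right-nested pairs that end in `0`. -/
def encList {α : Type} (f : α → Data) : List α → Data
  | [] => .int 0
  | a :: l => .pair (f a) (encList f l)

/-- Encoding of terms; a rational constant is given by its numerator and denominator. -/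
def Term.enc : Term → Data
  | .var n => .pair (.int 0) (.int n)
  | .const c => .pair (.int 1) (.pair (.int c.num) (.int c.den))

def Atom.enc (a : Atom) : Data :=
  .pair (.int a.rel) (encList Term.enc a.args)

def CompOp.enc : CompOp → Data
  | .lt => .int 0
  | .le => .int 1
  | .gt => .int 2
  | .ge => .int 3
  | .eq => .int 4
  | .ne => .int 5

def AC.enc (a : AC) : Data :=
  .pair a.op.enc (.pair (.int a.lhs) a.rhs.enc)

def Query.enc (Q : Query) : Data :=
  .pair (encList Term.enc Q.head) (.pair (encList Atom.enc Q.body) (encList AC.enc Q.acs))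

/-- The containment problem: given `(Q₁, Q₂)`, where the comparisons of `Q₁` are of the form
`X l c` or `X r c` with at most one of the latter, `Q₂` is any query, and the side condition
holds, decide whether `Q₂ ⊑ Q₁`. -/
def containmentProblem {D : Type*} [LinearOrder D] (ι : ℚ ↪o D) (l r : CompOp) :
    DecisionProblem where
  Inst := {P : Query × Query //
    P.1.WellFormed ι ∧ P.2.WellFormed ι ∧ P.1.InClass l r ∧ SideCondition ι P.1 P.2}
  enc P := .pair P.1.1.enc P.1.2.enc
  yes P := P.1.2.Contained ι P.1.1

end CQAC

/-!
Suppose that the head of `Q₂` is not among the answers of `Q₁` on the body of `Q₂`. Then every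
mapping of the subgoals of `Q₁` into those of `Q₂` that fixes the head and makes the LSIs of `Q₁`
true violates its single RSI: the comparisons of `Q₁` act as Horn clauses. Saturation is therefore a
refutation procedure: starting from the comparisons of `Q₂`, one closes under the laws of linear
orders and adds, for each mapping that respects the derived equalities and sends the LSIs to derived
formulas, the negation of the image of the RSI, or absurdity if the RSI is absent or its image is
derived as well. The containment holds if and only if absurdity is derivable.

Soundness is immediate. For completeness, a consistent saturated set of formulas has a generic
model, in which an equality or `t ≤ c` holds only if it is derived. The remaining obstruction is an
open LSI `t < c` that is true while only `t ≤ c` is derived, not `t ≠ c`. If `Q₁` is equation-free,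
such a `t` may be given the value `c`: conditions (a) and (b) ensure that the comparisons
`X ≠ Y` of `Q₂` survive. Otherwise `t ≤ c` would amount to a closed LSI of `Q₂`, against (c).

Only formulas over the terms of the two queries occur, so that a derivation has polynomially many
steps, and each step is checked in polynomial time once the mapping is given: a saturated
derivation is the certificate.
-/

/-! ### Polynomial-time programs and nondeterministic certificates -/

namespace Machine

namespace Data

/-- The first component of a datum; `0` on leaves. -/
def left (x : Data) : Data := Prim.fst.eval x

/-- The second component of a datum; `0` on leaves. -/
def right (x : Data) : Data := Prim.snd.eval x

/-- Multiplication of integer leaves; `0` on other data. -/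
def imul (a b : Data) : Data := Prim.mul.eval (.pair a b)

/-- The order of integer leaves; false on other data. -/
def ile (a b : Data) : Prop := Prim.le.eval (.pair a b) = .int 1

/-- The datum is not a leaf. -/
def IsPair (a : Data) : Prop := Prim.isPair.eval a = .int 1

open Classical in
/-- The truth value of a proposition: `1` if it is true, `0` if it is false. -/
noncomputable def ofProp (p : Prop) : Data := if p then int 1 else int 0

/-- The entries of a datum read as an encoded list. -/
def elems : Data → List Data
  | .int _ => []
  | .pair a b => a :: b.elems

@[simp] theorem left_pair (a b : Data) : (pair a b).left = a := rfl
@[simp] theorem right_pair (a b : Data) : (pair a b).right = b := rfl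
@[simp] theorem left_int (n : ℤ) : (int n).left = int 0 := rfl
@[simp] theorem right_int (n : ℤ) : (int n).right = int 0 := rfl
@[simp] theorem imul_int (m n : ℤ) : (int m).imul (int n) = int (m * n) := rfl
@[simp] theorem isPair_pair (a b : Data) : (pair a b).IsPair := rfl
@[simp] theorem elems_int (n : ℤ) : (int n).elems = [] := rfl
@[simp] theorem elems_pair (a b : Data) : (pair a b).elems = a :: b.elems := rfl

@[simp] theorem not_isPair_int (n : ℤ) : ¬ (int n).IsPair := by
  simp [IsPair, Prim.eval]

@[simp] theorem ile_int (m n : ℤ) : (int m).ile (int n) ↔ m ≤ n := by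
  simp [ile, Prim.eval]

@[simp] theorem size_zero : (int 0).size = 1 := by simp [size]

@[simp] theorem size_one : (int 1).size = 2 := by simp [size]

@[simp] theorem ofProp_eq_one_iff {p : Prop} : ofProp p = int 1 ↔ p := by
  by_cases h : p <;> simp [ofProp, h]

@[simp] theorem ofProp_eq_zero_iff {p : Prop} : ofProp p = int 0 ↔ ¬ p := by
  by_cases h : p <;> simp [ofProp, h]

theorem size_ofProp_le (p : Prop) : (ofProp p).size ≤ 2 := by
  by_cases h : p <;> simp [ofProp, h]

theorem one_le_size (x : Data) : 1 ≤ x.size := by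
  cases x <;> simp only [size] <;> omega

theorem size_left_le (x : Data) : x.left.size ≤ x.size := by
  cases x
  · simpa using one_le_size _
  · simp only [left_pair, size]; omega

theorem size_right_le (x : Data) : x.right.size ≤ x.size := by
  cases x <;> simp [size]

theorem size_int_mul_le (m n : ℤ) : (int (m * n)).size ≤ 1 + m.natAbs.size + n.natAbs.size := by
  have : (m.natAbs * n.natAbs).size ≤ m.natAbs.size + n.natAbs.size := by
    rw [Nat.size_le, pow_add]
    exact Nat.mul_lt_mul'' (Nat.lt_size_self _) (Nat.lt_size_self _)
  simp only [size, Int.natAbs_mul]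
  omega

theorem length_elems_right (x : Data) : x.right.elems.length = x.elems.length - 1 := by
  cases x <;> simp

theorem length_elems_le (x : Data) : x.elems.length ≤ x.size := by
  induction x with
  | int _ => simp
  | pair a b _ ih => simp only [elems_pair, List.length_cons, size]; omega

theorem isPair_iff_length_elems_ne_zero (x : Data) : x.IsPair ↔ x.elems.length ≠ 0 := by
  cases x <;> simp

end Data

section PolyTime

theorem Runs.output_unique {p : Prog} {x y : Data} {t : ℕ} (h : Runs p x y t) :
    ∀ {y' : Data} {t' : ℕ}, Runs p x y' t' → y = y' := by
  induction h with
  | prim o x => intro y' t' h; cases h; rfl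
  | const d x => intro y' t' h; cases h; rfl
  | pair _ _ ih1 ih2 =>
    intro y' t' h; cases h with
    | pair h1 h2 => rw [ih1 h1, ih2 h2]
  | comp _ _ ih1 ih2 =>
    intro y' t' h; cases h with
    | comp h1 h2 => obtain rfl := ih1 h1; exact ih2 h2
  | iteTrue _ hb _ ih1 ih2 =>
    intro y' t' h; cases h with
    | iteTrue _ _ h2 => exact ih2 h2
    | iteFalse h1 _ => exact absurd (ih1 h1) hb
  | iteFalse _ _ ih1 ih2 =>
    intro y' t' h; cases h with
    | iteTrue h1 hb _ => exact absurd (ih1 h1).symm hb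
    | iteFalse _ h2 => exact ih2 h2
  | loopStop _ ih =>
    intro y' t' h; cases h with
    | loopStop _ => rfl
    | loopStep h1 hb _ _ => exact absurd (ih h1).symm hb
  | loopStep _ hb _ _ ih1 ih2 ih3 =>
    intro y' t' h; cases h with
    | loopStop h1 => exact absurd (ih1 h1) hb
    | loopStep _ _ h2 h3 => obtain rfl := ih2 h2; exact ih3 h3

theorem Runs.size_le {p : Prog} {x y : Data} {t : ℕ} (h : Runs p x y t) : y.size ≤ t := by
  induction h <;> first | omega | (simp only [Data.size]; omega)

theorem eval_le_eval (q : Polynomial ℕ) {m n : ℕ} (h : m ≤ n) : q.eval m ≤ q.eval n := by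
  simp only [Polynomial.eval_eq_sum, Polynomial.sum]
  gcongr

/-- The function `f` is computed by a program in polynomial time. -/
@[fun_prop]
def PolyTime (f : Data → Data) : Prop :=
  ∃ (p : Prog) (q : Polynomial ℕ), ∀ x, ∃ t, Runs p x (f x) t ∧ t ≤ q.eval x.size

/-- The predicate `P` is decided by a program in polynomial time. -/
@[fun_prop]
def PolyTimePred (P : Data → Prop) : Prop :=
  PolyTime fun x => .ofProp (P x)

theorem PolyTime.prim {o : Prim} (h : ∀ x, (o.eval x).size ≤ x.size + 1) : PolyTime o.eval := by
  refine ⟨.prim o, 2 * Polynomial.X + 2, fun x => ⟨_, .prim o x, ?_⟩⟩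
  have := h x
  simp only [Polynomial.eval_add, Polynomial.eval_mul, Polynomial.eval_X, Polynomial.eval_ofNat]
  omega

@[fun_prop]
theorem PolyTime.id : PolyTime fun x => x :=
  PolyTime.prim (o := .id) fun _ => Nat.le_succ _

@[fun_prop]
theorem PolyTime.const (d : Data) : PolyTime fun _ => d :=
  ⟨.const d, Polynomial.C (1 + d.size), fun x => ⟨_, .const d x, by simp⟩⟩

variable {f g c : Data → Data} {P Q : Data → Prop}

@[fun_prop]
theorem PolyTime.comp (hg : PolyTime g) (hf : PolyTime f) : PolyTime fun x => g (f x) := by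
  obtain ⟨pg, qg, hg⟩ := hg
  obtain ⟨pf, qf, hf⟩ := hf
  refine ⟨.comp pg pf, qf + qg.comp qf + 1, fun x => ?_⟩
  obtain ⟨s, h1, hs⟩ := hf x
  obtain ⟨t, h2, ht⟩ := hg (f x)
  refine ⟨_, .comp h1 h2, ?_⟩
  have := eval_le_eval qg (h1.size_le.trans hs)
  simp only [Polynomial.eval_add, Polynomial.eval_comp, Polynomial.eval_one]
  omega

@[fun_prop]
theorem PolyTime.pair (hf : PolyTime f) (hg : PolyTime g) :
    PolyTime fun x => .pair (f x) (g x) := by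
  obtain ⟨pg, qg, hg⟩ := hg
  obtain ⟨pf, qf, hf⟩ := hf
  refine ⟨.pair pf pg, qf + qg + qf + qg + 1 + Polynomial.X, fun x => ?_⟩
  obtain ⟨s, h1, hs⟩ := hf x
  obtain ⟨t, h2, ht⟩ := hg x
  refine ⟨_, .pair h1 h2, ?_⟩
  have := h1.size_le
  have := h2.size_le
  simp only [Polynomial.eval_add, Polynomial.eval_X, Polynomial.eval_one]
  omega

theorem PolyTime.ite_eq_zero (hc : PolyTime c) (hf : PolyTime f) (hg : PolyTime g) :
    PolyTime fun x => if c x = .int 0 then f x else g x := by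
  obtain ⟨pc, qc, hc⟩ := hc
  obtain ⟨pg, qg, hg⟩ := hg
  obtain ⟨pf, qf, hf⟩ := hf
  refine ⟨.ite pc pg pf, qc + qf + qg + 1 + Polynomial.X, fun x => ?_⟩
  obtain ⟨s, h1, hs⟩ := hc x
  obtain ⟨t, h2, ht⟩ := hf x
  obtain ⟨u, h3, hu⟩ := hg x
  simp only [Polynomial.eval_add, Polynomial.eval_X, Polynomial.eval_one]
  by_cases h : c x = .int 0
  · rw [if_pos h]
    rw [h] at h1
    exact ⟨_, .iteFalse h1 h2, by omega⟩
  · rw [if_neg h]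
    exact ⟨_, .iteTrue h1 h h3, by omega⟩

@[fun_prop]
theorem PolyTime.left (hf : PolyTime f) : PolyTime fun x => (f x).left :=
  PolyTime.comp (g := Data.left)
    (.prim (o := .fst) fun x => (Data.size_left_le x).trans (Nat.le_succ _)) hf

@[fun_prop]
theorem PolyTime.right (hf : PolyTime f) : PolyTime fun x => (f x).right :=
  PolyTime.comp (g := Data.right)
    (.prim (o := .snd) fun x => (Data.size_right_le x).trans (Nat.le_succ _)) hf

@[fun_prop]
theorem PolyTime.imul (hf : PolyTime f) (hg : PolyTime g) :
    PolyTime fun x => (f x).imul (g x) := by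
  refine PolyTime.comp (.prim (o := .mul) fun x => ?_) (hf.pair hg)
  rcases x with n | ⟨_ | _, _ | _⟩
  case pair.int.int m n =>
    have := Data.size_int_mul_le m n
    simp only [Prim.eval]
    simp only [Data.size] at *
    omega
  all_goals simp [Prim.eval]

@[fun_prop]
theorem PolyTimePred.comp (hP : PolyTimePred P) (hf : PolyTime f) :
    PolyTimePred fun x => P (f x) :=
  PolyTime.comp hP hf

@[fun_prop]
theorem PolyTimePred.const (C : Prop) : PolyTimePred fun _ => C := PolyTime.const _

@[fun_prop]
theorem PolyTime.ite [DecidablePred P] (hP : PolyTimePred P) (hf : PolyTime f) (hg : PolyTime g) :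
    PolyTime fun x => if P x then f x else g x := by
  simpa only [Data.ofProp_eq_zero_iff, ite_not] using PolyTime.ite_eq_zero hP hg hf

@[fun_prop]
theorem PolyTimePred.not (hP : PolyTimePred P) : PolyTimePred fun x => ¬ P x := by
  classical
  unfold PolyTimePred
  convert PolyTime.ite hP (.const (.int 0)) (.const (.int 1)) using 2 with x
  by_cases h : P x <;> simp [Data.ofProp, h]

@[fun_prop]
theorem PolyTimePred.and (hP : PolyTimePred P) (hQ : PolyTimePred Q) :
    PolyTimePred fun x => P x ∧ Q x := by
  classical
  unfold PolyTimePred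
  convert PolyTime.ite hP hQ (.const (.int 0)) using 2 with x
  by_cases h : P x <;> by_cases h' : Q x <;> simp [Data.ofProp, h, h']

@[fun_prop]
theorem PolyTimePred.or (hP : PolyTimePred P) (hQ : PolyTimePred Q) :
    PolyTimePred fun x => P x ∨ Q x := by
  simpa only [not_and_or, not_not] using (hP.not.and hQ.not).not

@[fun_prop]
theorem PolyTimePred.imp (hP : PolyTimePred P) (hQ : PolyTimePred Q) :
    PolyTimePred fun x => P x → Q x := by
  simpa only [imp_iff_not_or] using hP.not.or hQ

@[fun_prop]
theorem PolyTimePred.eq (hf : PolyTime f) (hg : PolyTime g) :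
    PolyTimePred fun x => f x = g x := by
  have prim_eq : PolyTime Prim.eq.eval := PolyTime.prim fun x => by
    rcases x with n | ⟨a, b⟩
    · simp [Prim.eval]
    · have := a.one_le_size
      by_cases h : a = b
      · simp only [Prim.eval, h, if_true, Data.size_one, Data.size]; omega
      · simp only [Prim.eval, h, if_false, Data.size_zero, Data.size]; omega
  unfold PolyTimePred
  convert prim_eq.comp (hf.pair hg) using 2 with x
  simp only [Data.ofProp, Prim.eval]
  congr

@[fun_prop]
theorem PolyTimePred.isPair (hf : PolyTime f) : PolyTimePred fun x => (f x).IsPair :=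
  .eq (.comp (.prim (o := .isPair) fun x => by
    have := x.one_le_size
    cases x <;> simp [Prim.eval] ; omega) hf) (.const _)

@[fun_prop]
theorem PolyTimePred.ile (hf : PolyTime f) (hg : PolyTime g) :
    PolyTimePred fun x => (f x).ile (g x) := by
  refine .eq (.comp (.prim (o := .le) fun x => ?_) (hf.pair hg)) (.const _)
  rcases x with n | ⟨_ | _, _ | _⟩
  case pair.int.int m n => by_cases h : m ≤ n <;> simp [Prim.eval, h, Data.size] ; omega
  all_goals simp [Prim.eval]

theorem PolyTime.iterate (hc : PolyTime c) (hf : PolyTime f) {n : Data → ℕ} {k : ℕ}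
    (hcn : ∀ x, c x = .int 0 ↔ n x = 0) (hn : ∀ x, n (f x) = n x - 1)
    (hsize : ∀ x, (f x).size ≤ x.size + k) (hle : ∀ x, n x ≤ x.size) :
    PolyTime fun x => f^[n x] x := by
  obtain ⟨pc, qc, hc⟩ := hc
  obtain ⟨pf, qf, hf⟩ := hf
  have key : ∀ (M j : ℕ) (x : Data), n x = j → x.size + k * j ≤ M →
      ∃ t, Runs (.loop pc pf) x (f^[j] x) t ∧
        t ≤ (j + 1) * (qc.eval M + qf.eval M + 1 + M) := by
    intro M j
    induction j with
    | zero =>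
      intro x hx hM
      obtain ⟨s, h, hs⟩ := hc x
      rw [(hcn x).2 hx] at h
      refine ⟨_, .loopStop h, ?_⟩
      have := eval_le_eval qc (show x.size ≤ M by omega)
      omega
    | succ j ih =>
      intro x hx hM
      rw [mul_add_one] at hM
      obtain ⟨s, h, hs⟩ := hc x
      obtain ⟨u, h', hu⟩ := hf x
      have := hsize x
      obtain ⟨w, h'', hw⟩ := ih (f x) (by rw [hn, hx]; omega) (by omega)
      refine ⟨_, .loopStep h (mt (hcn x).1 (by omega)) h' h'', ?_⟩
      have := eval_le_eval qc (show x.size ≤ M by omega)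
      have := eval_le_eval qf (show x.size ≤ M by omega)
      rw [add_mul _ 1 (_ : ℕ)]
      omega
  let N : Polynomial ℕ := (1 + Polynomial.C k) * Polynomial.X
  refine ⟨.loop pc pf, (Polynomial.X + 1) * (qc.comp N + qf.comp N + 1 + N), fun x => ?_⟩
  have hx := hle x
  obtain ⟨t, h, ht⟩ := key ((1 + k) * x.size) (n x) x rfl (by rw [add_mul, one_mul]; gcongr)
  refine ⟨t, h, ht.trans ?_⟩
  simp only [N, Polynomial.eval_add, Polynomial.eval_mul, Polynomial.eval_comp, Polynomial.eval_X,
    Polynomial.eval_C, Polynomial.eval_one]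
  gcongr

end PolyTime

section Scan

/-- Simultaneous scan of two encoded lists: `R` holds between each entry of the first list and the
corresponding rest of the second list, and `B` holds for what is left of the second list when the
first one is exhausted. -/
def Scan (R : Data → Data → Prop) (B : Data → Prop) : Data → Data → Prop
  | .int _, m => B m
  | .pair e t, m => R e m ∧ Scan R B t m.right

/-- One round of the loop that decides `Scan (R z) B l m`.  Its states are `(z, (b, (l, m)))` with
`z` a parameter and `b` the truth value found so far. -/
noncomputable def scanStep (R : Data → Data → Data → Prop) (s : Data) : Data :=
  .pair s.left
    (.pair (.ofProp (s.right.left = .int 1 ∧ R s.left s.right.right.left.left s.right.right.right))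
      (.pair s.right.right.left.right s.right.right.right.right))

variable {R : Data → Data → Data → Prop} {B : Data → Prop} {f g : Data → Data}

theorem iterate_scanStep_iff (l z b m : Data) :
    ((scanStep R)^[l.elems.length] (.pair z (.pair b (.pair l m)))).right.left = .int 1 ∧
      B ((scanStep R)^[l.elems.length] (.pair z (.pair b (.pair l m)))).right.right.right ↔
      b = .int 1 ∧ Scan (R z) B l m := by
  induction l generalizing b m with
  | int _ => simp [Scan]
  | pair e t _ ih =>
    have round : scanStep R (.pair z (.pair b (.pair (.pair e t) m))) =
      .pair z (.pair (.ofProp (b = .int 1 ∧ R z e m)) (.pair t m.right)) := rfl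
    rw [Data.elems_pair, List.length_cons, Function.iterate_succ_apply, round, ih, Scan,
      Data.ofProp_eq_one_iff, and_assoc]

theorem size_scanStep_le (s : Data) : (scanStep R s).size ≤ s.size + 8 := by
  unfold scanStep
  have := Data.size_ofProp_le
    (s.right.left = .int 1 ∧ R s.left s.right.right.left.left s.right.right.right)
  rcases s with n | ⟨z, n | ⟨c, n | ⟨l, m⟩⟩⟩ <;> simp only [Data.size, Data.left_pair,
    Data.right_pair, Data.left_int, Data.right_int, Data.size_zero] at this ⊢
  · omega
  · omega
  · omega
  · have := l.size_right_le
    have := m.size_right_le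
    have := c.one_le_size
    omega

theorem polyTime_scanStep (hR : PolyTimePred fun w => R w.left w.right.left w.right.right) :
    PolyTime (scanStep R) := by
  have hR' := hR.comp
    (f := fun s => .pair s.left (.pair s.right.right.left.left s.right.right.right)) (by fun_prop)
  have hbit := (PolyTimePred.eq PolyTime.id.right.left (.const (.int 1))).and hR'
  exact .pair (by fun_prop) (.pair hbit (by fun_prop))

theorem PolyTimePred.scan (hR : PolyTimePred fun w => R w.left w.right.left w.right.right)
    (hB : PolyTimePred B) (hf : PolyTime f) (hg : PolyTime g) :
    PolyTimePred fun z => Scan (R z) B (f z) (g z) := by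
  have hloop : PolyTime fun s => (scanStep R)^[s.right.right.left.elems.length] s :=
    PolyTime.iterate (c := fun s => .ofProp s.right.right.left.IsPair) (k := 8)
      (PolyTimePred.isPair (by fun_prop)) (polyTime_scanStep hR)
      (fun s => by simp [Data.isPair_iff_length_elems_ne_zero])
      (fun s => by simp [scanStep, Data.length_elems_right]) size_scanStep_le
      (fun s => (Data.length_elems_le _).trans ((Data.size_left_le _).trans
        ((Data.size_right_le _).trans (Data.size_right_le _))))
  have hend := hloop.comp (f := fun z => .pair z (.pair (.int 1) (.pair (f z) (g z))))
    (by fun_prop)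
  simpa only [Data.left_pair, Data.right_pair, iterate_scanStep_iff, true_and] using
    (PolyTimePred.eq hend.right.left (.const (.int 1))).and (hB.comp hend.right.right.right)

theorem scan_forall_iff {P : Data → Prop} (l m : Data) :
    Scan (fun e _ => P e) (fun _ => True) l m ↔ ∀ e ∈ l.elems, P e := by
  induction l generalizing m with
  | int _ => simp [Scan]
  | pair e t _ ih => simp [Scan, ih]

variable {P : Data → Data → Prop}

theorem PolyTimePred.forall_elems (hg : PolyTime g)
    (hP : PolyTimePred fun w => P w.left w.right) :
    PolyTimePred fun z => ∀ e ∈ (g z).elems, P z e := by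
  have hR := hP.comp (f := fun w => .pair w.left w.right.left) (by fun_prop)
  simpa only [scan_forall_iff] using PolyTimePred.scan (R := fun z e _ => P z e) hR (.const True)
    hg hg

theorem PolyTimePred.exists_elems (hg : PolyTime g)
    (hP : PolyTimePred fun w => P w.left w.right) :
    PolyTimePred fun z => ∃ e ∈ (g z).elems, P z e := by
  simpa only [not_forall, not_not, exists_prop] using
    (PolyTimePred.forall_elems (P := fun z e => ¬ P z e) hg hP.not).not

end Scan

section Derivation

/-- An encoded list of pairs `(f, H)`, latest first, is a derivation if each `f` follows, with the
help of the hint `H`, from the earlier entries `L` according to the judgement `J f H L`. -/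
def IsDerivation (J : Data → Data → Data → Prop) : Data → Prop
  | .int _ => True
  | .pair e t => J e.left e.right t ∧ IsDerivation J t

/-- The datum `f` is the conclusion of an entry of the list `L` of pairs of conclusions and
hints. -/
def Known (L f : Data) : Prop := ∃ e ∈ L.elems, e.left = f

theorem IsDerivation.forall_known {J : Data → Data → Data → Prop} {p : Data → Prop}
    (step : ∀ f H L, J f H L → (∀ g, Known L g → p g) → p f) {C : Data} (hC : IsDerivation J C) :
    ∀ f, Known C f → p f := by
  induction C with
  | int _ => simp [Known]
  | pair e t _ ih =>
    rintro f ⟨e', he', rfl⟩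
    rcases List.mem_cons.1 he' with rfl | he'
    · exact step _ _ _ hC.1 (ih hC.2)
    · exact ih hC.2 _ ⟨e', he', rfl⟩

theorem exists_saturated_derivation (J : Data → Data → Data → Prop) {U : Finset Data} {K : ℕ}
    (hU : ∀ f ∈ U, f.size ≤ K) (k : ℕ) :
    ∃ C, IsDerivation J C ∧ C.size ≤ 1 + U.card * (K + k + 2) ∧
      ∀ f ∈ U, ∀ H, H.size ≤ k → J f H C → Known C f := by
  -- A longest derivation without repeated conclusions in `U` will do.
  let conclusions (C : Data) := C.elems.map Data.left
  by_contra! h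
  have grow (n : ℕ) : ∃ C, IsDerivation J C ∧ (conclusions C).Nodup ∧
      (∀ f ∈ conclusions C, f ∈ U) ∧ (conclusions C).length = n ∧
      C.size ≤ 1 + n * (K + k + 2) := by
    induction n with
    | zero => exact ⟨.int 0, trivial, by simp [conclusions]⟩
    | succ n ih =>
      obtain ⟨C, hC, hnodup, hmem, hlen, hsize⟩ := ih
      have hn : n ≤ U.card := by
        rw [← hlen, ← List.toFinset_card_of_nodup hnodup]
        exact Finset.card_le_card fun f hf => hmem f (List.mem_toFinset.1 hf)
      obtain ⟨f, hf, H, hH, hJ, hnew⟩ := h C hC (hsize.trans (by gcongr))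
      refine ⟨.pair (.pair f H) C, ⟨hJ, hC⟩, List.nodup_cons.2 ⟨?_, hnodup⟩, ?_, ?_, ?_⟩
      · exact fun hold => hnew (List.mem_map.1 hold)
      · exact List.forall_mem_cons.2 ⟨hf, hmem⟩
      · exact congrArg (· + 1) hlen
      · have := hU f hf
        simp only [Data.size]
        rw [add_one_mul]
        omega
  obtain ⟨C, -, hnodup, hmem, hlen, -⟩ := grow (U.card + 1)
  have := Finset.card_le_card fun f hf => hmem f (List.mem_toFinset.1 hf)
  rw [List.toFinset_card_of_nodup hnodup] at this
  omega

variable {f g : Data → Data}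

@[fun_prop]
theorem PolyTimePred.known (hf : PolyTime f) (hg : PolyTime g) :
    PolyTimePred fun z => Known (f z) (g z) :=
  .comp (P := fun w => Known w.left w.right) (.exists_elems (by fun_prop) (by fun_prop))
    (hf.pair hg)

theorem PolyTimePred.isDerivation {J : Data → Data → Data → Data → Prop}
    (hJ : PolyTimePred fun w => J w.left w.right.left.left w.right.left.right w.right.right)
    (hf : PolyTime f) : PolyTimePred fun z => IsDerivation (J z) (f z) := by
  have scan_iff (J : Data → Data → Data → Prop) (C : Data) :
      Scan (fun e t => J e.left e.right t) (fun _ => True) C C.right ↔ IsDerivation J C := by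
    induction C with
    | int _ => rfl
    | pair e t _ ih => exact and_congr_right fun _ => ih
  simpa only [scan_iff] using
    PolyTimePred.scan (R := fun z e t => J z e.left e.right t) hJ (.const True) hf hf.right

end Derivation

section NP

theorem exists_NP_of_certificates {P : Data → Data → Prop}
    (hP : PolyTimePred fun w => P w.left w.right) (p : Polynomial ℕ) :
    ∃ L : Set Data, NP L ∧ ∀ x, x ∈ L ↔ ∃ y : Data, y.size ≤ p.eval x.size ∧ P x y := by
  obtain ⟨V, q, hV⟩ := hP
  refine ⟨{x | ∃ y : Data, y.size ≤ p.eval x.size ∧ ∃ t, Runs V (.pair x y) (.int 1) t},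
    ⟨V, p, q.comp (1 + Polynomial.X + p), fun x y hy => ?_, fun x => Iff.rfl⟩, fun x => ?_⟩
  · obtain ⟨t, h, ht⟩ := hV (.pair x y)
    refine ⟨_, t, h, ht.trans ?_⟩
    simp only [Polynomial.eval_comp, Polynomial.eval_add, Polynomial.eval_one, Polynomial.eval_X]
    exact eval_le_eval q (by simp only [Data.size]; omega)
  · refine exists_congr fun y => and_congr_right fun _ => ?_
    obtain ⟨t, h, -⟩ := hV (.pair x y)
    constructor
    · rintro ⟨t', h'⟩
      exact Data.ofProp_eq_one_iff.1 (h.output_unique h')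
    · intro hy
      exact ⟨t, Data.ofProp_eq_one_iff.2 hy ▸ h⟩

theorem DecisionProblem.InNP.of_embedding {P Q : DecisionProblem} (hP : P.InNP)
    (φ : Q.Inst → P.Inst) (henc : ∀ I, P.enc (φ I) = Q.enc I) (hyes : ∀ I, P.yes (φ I) ↔ Q.yes I) :
    Q.InNP := by
  obtain ⟨L, hL, h⟩ := hP
  exact ⟨L, hL, fun I => by rw [← henc, h, hyes]⟩

end NP

end Machine

/-! ### Order extensions and generic models -/

namespace CQAC

section OrderExtension

universe u

/-- The relation that extends `≤` by placing everything that is not below an element `c` of `K`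
above all the elements that are below `c`. -/
def LECut {α : Type*} [LE α] (K : Set α) (a b : α) : Prop := a ≤ b ∨ ∃ c ∈ K, a ≤ c ∧ ¬ b ≤ c

theorem LECut.trans {α : Type*} [Preorder α] {K : Set α} (hK : IsChain (· ≤ ·) K) {a b d : α} :
    LECut K a b → LECut K b d → LECut K a d := by
  rintro (hab | ⟨c, hc, hac, hbc⟩) (hbd | ⟨c', hc', hbc', hdc'⟩)
  · exact .inl (hab.trans hbd)
  · exact .inr ⟨c', hc', hab.trans hbc', hdc'⟩
  · exact .inr ⟨c, hc, hac, fun hdc => hbc (hbd.trans hdc)⟩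
  · have hcc' : c ≤ c' := (hK.total hc hc').resolve_right fun h => hbc (hbc'.trans h)
    exact .inr ⟨c', hc', hac.trans hcc', hdc'⟩

theorem LECut.le_of_symm {α : Type*} [Preorder α] {K : Set α} (hK : IsChain (· ≤ ·) K) {a b : α} :
    LECut K a b → LECut K b a → a ≤ b := by
  rintro (hab | ⟨c, hc, hac, hbc⟩) (hba | ⟨c', hc', hbc', hac'⟩)
  · exact hab
  · exact hab
  · exact absurd (hba.trans hac) hbc
  · rcases hK.total hc hc' with h | h
    · exact absurd (hac.trans h) hac'
    · exact absurd (hbc'.trans h) hbc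

theorem exists_linearOrder_of_isChain {α : Type u} [PartialOrder α] {K : Set α}
    (hK : IsChain (· ≤ ·) K) :
    ∃ (β : Type u) (_ : LinearOrder β) (e : α ≃ β), Monotone e ∧
      ∀ a, ∀ c ∈ K, e a ≤ e c → a ≤ c := by
  have : IsPartialOrder α (LECut K) :=
    { refl := fun _ => .inl le_rfl
      trans := fun _ _ _ => LECut.trans hK
      antisymm := fun _ _ hab hba =>
        le_antisymm (hab.le_of_symm hK hba) (hba.le_of_symm hK hab) }
  obtain ⟨s, _, hs⟩ := extend_partialOrder (LECut K)
  refine ⟨α,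
    { le := s
      lt := fun a b => s a b ∧ ¬ s b a
      le_refl := refl_of s
      le_trans := fun _ _ _ => trans_of s
      le_antisymm := fun _ _ => antisymm_of s
      le_total := total_of s
      toDecidableLE := Classical.decRel s },
    Equiv.refl α, fun a b h => hs a b (.inl h), fun a c hc (h : s a c) => ?_⟩
  by_contra hac
  exact hac (antisymm_of s h (hs c a (.inr ⟨c, hc, le_rfl, hac⟩))).le

theorem exists_generic_linear_quotient {α : Type u} [Preorder α] {K : Set α}
    (hK : IsChain (· ≤ ·) K) :
    ∃ (β : Type u) (_ : LinearOrder β) (key : α → β), Monotone key ∧ key.Surjective ∧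
      (∀ a b, key a = key b → a ≤ b) ∧ ∀ a, ∀ c ∈ K, key a ≤ key c → a ≤ c := by
  have hchain : IsChain (· ≤ ·) (toAntisymmetrization (α := α) (· ≤ ·) '' K) := by
    rintro _ ⟨c, hc, rfl⟩ _ ⟨d, hd, rfl⟩ -
    exact hK.total hc hd
  obtain ⟨β, _, e, he, heK⟩ := exists_linearOrder_of_isChain hchain
  exact ⟨β, _, fun a => e (toAntisymmetrization (· ≤ ·) a), fun a b h => he h,
    e.surjective.comp Quotient.mk_surjective, fun a b h => (e.injective h).le,
    fun a c hc h => heK _ _ (Set.mem_image_of_mem _ hc) h⟩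

section Dense

variable {β D : Type*} [LinearOrder β] [LinearOrder D] [DenselyOrdered D] [NoMinOrder D]
  [NoMaxOrder D] [Nonempty D]

theorem exists_strictMonoOn_update {S : Set β} (hS : S.Finite) {f : β → D} (hf : StrictMonoOn f S)
    {b : β} (hb : b ∉ S) : ∃ d, StrictMonoOn (Function.update f b d) (insert b S) := by
  obtain ⟨d, hlo, hhi⟩ := Order.exists_between_finsets
    ((hS.inter_of_left (Set.Iio b)).image f).toFinset
    ((hS.inter_of_left (Set.Ioi b)).image f).toFinset (by
      simp only [Set.Finite.mem_toFinset, Set.forall_mem_image]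
      exact fun x hx y hy => hf hx.1 hy.1 (hx.2.trans hy.2))
  simp only [Set.Finite.mem_toFinset, Set.forall_mem_image] at hlo hhi
  have hne {x : β} (hx : x ∈ S) : x ≠ b := ne_of_mem_of_not_mem hx hb
  refine ⟨d, strictMonoOn_insert_iff.2 ⟨fun x hx hxb => ?_, fun x hx hbx => ?_, ?_⟩⟩
  · rw [Function.update_self, Function.update_of_ne (hne hx)]
    exact hlo ⟨hx, hxb⟩
  · rw [Function.update_self, Function.update_of_ne (hne hx)]
    exact hhi ⟨hx, hbx⟩
  · exact hf.congr fun x hx => (Function.update_of_ne (hne hx) _ _).symm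

theorem exists_strictMono_extension [Finite β] {S : Set β} {f : β → D}
    (hf : StrictMonoOn f S) : ∃ g : β → D, StrictMono g ∧ Set.EqOn g f S := by
  suffices h : ∀ T : Set β, T.Finite → ∃ g : β → D, StrictMonoOn g (S ∪ T) ∧ Set.EqOn g f S by
    obtain ⟨g, hg, hgf⟩ := h Set.univ Set.finite_univ
    exact ⟨g, by rwa [Set.union_univ, strictMonoOn_univ] at hg, hgf⟩
  intro T hT
  induction T, hT using Set.Finite.induction_on with
  | empty => exact ⟨f, by rwa [Set.union_empty], fun _ _ => rfl⟩
  | @insert b T _ _ ih =>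
    obtain ⟨g, hg, hgf⟩ := ih
    rw [Set.union_insert]
    by_cases hb : b ∈ S ∪ T
    · exact ⟨g, by rwa [Set.insert_eq_of_mem hb], hgf⟩
    · obtain ⟨d, hd⟩ := exists_strictMonoOn_update (Set.toFinite _) hg hb
      refine ⟨_, hd, fun x hx => ?_⟩
      rw [Function.update_of_ne (ne_of_mem_of_not_mem (Or.inl hx) hb), hgf hx]

end Dense

theorem exists_generic_monotone {α D : Type*} [Preorder α] [Finite α] [LinearOrder D]
    [DenselyOrdered D] [NoMinOrder D] [NoMaxOrder D] {K : Set α} {f : α → D}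
    (hf : ∀ c ∈ K, ∀ d ∈ K, f c ≤ f d ↔ c ≤ d) :
    ∃ g : α → D, Monotone g ∧ Set.EqOn g f K ∧ (∀ a b, g a = g b → a ≤ b) ∧
      ∀ a, ∀ c ∈ K, g a ≤ g c → a ≤ c := by
  rcases isEmpty_or_nonempty α with _ | hα
  · exact ⟨f, isEmptyElim, isEmptyElim, isEmptyElim, isEmptyElim⟩
  have : Nonempty D := hα.map f
  obtain ⟨β, _, key, key_mono, key_surj, le_of_key_eq, le_of_key_le⟩ :=
    exists_generic_linear_quotient (K := K) fun c hc d hd _ => by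
      simpa only [hf c hc d hd, hf d hd c hc] using le_total (f c) (f d)
  have : Finite β := .of_surjective key key_surj
  let h : β → D := fun b => f (Function.invFunOn key K b)
  have h_key (c : α) (hc : c ∈ K) : h (key c) = f c := by
    have hmem := Function.invFunOn_mem (f := key) (b := key c) ⟨c, hc, rfl⟩
    have heq := Function.invFunOn_eq (f := key) (b := key c) ⟨c, hc, rfl⟩
    exact le_antisymm ((hf _ hmem c hc).2 (le_of_key_eq _ _ heq))
      ((hf c hc _ hmem).2 (le_of_key_eq _ _ heq.symm))
  obtain ⟨g, hg, hgh⟩ := exists_strictMono_extension (f := h) (S := key '' K) (by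
    rintro _ ⟨c, hc, rfl⟩ _ ⟨d, hd, rfl⟩ hcd
    rw [h_key c hc, h_key d hd, ← not_le, hf d hd c hc]
    exact fun hdc => (key_mono hdc).not_gt hcd)
  exact ⟨g ∘ key, hg.monotone.comp key_mono,
    fun c hc => (hgh (Set.mem_image_of_mem key hc)).trans (h_key c hc),
    fun a b hab => le_of_key_eq a b (hg.injective hab),
    fun a c hc hac => le_of_key_le a c hc (hg.le_iff_le.1 hac)⟩

end OrderExtension

/-! ### The refutation system -/

section ProofSystem

/-- The formulas of the refutation system: absurdity, `a ≤ b` and `a ≠ b`.  A strict comparison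
is the conjunction of the other two kinds. -/
inductive Formula where
  | bot : Formula
  | le (a b : Term) : Formula
  | ne (a b : Term) : Formula

/-- The terms occurring in a formula. -/
def Formula.terms : Formula → List Term
  | .bot => []
  | .le a b => [a, b]
  | .ne a b => [a, b]

/-- The conjuncts expressing the comparison `a θ b`. -/
def CompOp.formulas (a b : Term) : CompOp → List Formula
  | .lt => [.le a b, .ne a b]
  | .le => [.le a b]
  | .gt => [.le b a, .ne b a]
  | .ge => [.le b a]
  | .eq => [.le a b, .le b a]
  | .ne => [.ne a b]

/-- The comparison symbol of the negated comparison. -/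
def CompOp.neg : CompOp → CompOp
  | .lt => .ge
  | .le => .gt
  | .gt => .le
  | .ge => .lt
  | .eq => .ne
  | .ne => .eq

/-- Substitution of terms for variables. -/
def Term.subst (σ : ℕ → Term) : Term → Term
  | .var n => σ n
  | .const c => .const c

/-- The conjuncts expressing the image of a comparison under a substitution. -/
def AC.image (σ : ℕ → Term) (c : AC) : List Formula :=
  c.op.formulas (σ c.lhs) (c.rhs.subst σ)

/-- A right semi-interval comparison `X ≥ t` or `X > t`. -/
def AC.IsRSI (c : AC) : Prop :=
  c.op = .ge ∨ c.op = .gt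

/-- All occurrences of terms in a query. -/
def Query.terms (Q : Query) : List Term :=
  Q.head ++ Q.body.flatMap Atom.args ++ Q.acs.flatMap fun c => [.var c.lhs, c.rhs]

/-- `a` and `b` are equal according to the formulas in `S`. -/
def Equated (S : Set Formula) (a b : Term) : Prop :=
  .le a b ∈ S ∧ .le b a ∈ S

/-- `σ` is a containment mapping from the head and the relational subgoals of `Q₁` to those of
`Q₂`, up to the equalities in `S`.  Its values are restricted to the terms of the two queries, so
that derivations only involve polynomially many formulas. -/
structure IsMapping (Q₁ Q₂ : Query) (S : Set Formula) (σ : ℕ → Term) : Prop where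
  terms : ∀ s ∈ Q₁.terms, s.subst σ ∈ Q₁.terms ++ Q₂.terms
  head : List.Forall₂ (fun s t => Equated S (s.subst σ) t) Q₁.head Q₂.head
  body : ∀ a ∈ Q₁.body, ∃ b ∈ Q₂.body, a.rel = b.rel ∧
    List.Forall₂ (fun s t => Equated S (s.subst σ) t) a.args b.args

/-- `Step Q₁ Q₂ S f`: under the assumption that the canonical answer of `Q₂` is not an answer to
`Q₁`, the formula `f` follows from those in `S` by a single rule. -/
inductive Step (Q₁ Q₂ : Query) (S : Set Formula) : Formula → Prop where
  | comparison {c f} : c ∈ Q₂.acs → f ∈ c.op.formulas (.var c.lhs) c.rhs → Step Q₁ Q₂ S f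
  | const_le {c d : ℚ} : c ≤ d → Step Q₁ Q₂ S (.le (.const c) (.const d))
  | const_ne {c d : ℚ} : c ≠ d → Step Q₁ Q₂ S (.ne (.const c) (.const d))
  | refl (a) : Step Q₁ Q₂ S (.le a a)
  | trans {a b c} : .le a b ∈ S → .le b c ∈ S → Step Q₁ Q₂ S (.le a c)
  | ne_between {a b u w} : .ne u w ∈ S → .le a u ∈ S → .le u b ∈ S → .le a w ∈ S → .le w b ∈ S →
      Step Q₁ Q₂ S (.ne a b)
  | contradiction {a} : .ne a a ∈ S → Step Q₁ Q₂ S .bot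
  | mapping_bot {σ} : IsMapping Q₁ Q₂ S σ → (∀ c ∈ Q₁.acs, ∀ f ∈ c.image σ, f ∈ S) →
      Step Q₁ Q₂ S .bot
  | mapping_neg {σ c f} : IsMapping Q₁ Q₂ S σ → c ∈ Q₁.acs → c.IsRSI →
      (∀ c' ∈ Q₁.acs, c' ≠ c → ∀ g ∈ c'.image σ, g ∈ S) →
      f ∈ c.op.neg.formulas (σ c.lhs) (c.rhs.subst σ) → Step Q₁ Q₂ S f

/-- Derivability in the refutation system for `Q₂ ⊑ Q₁`, in terms of the two queries only. -/
inductive Derivable (Q₁ Q₂ : Query) : Formula → Prop where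
  | step {S : Set Formula} {f : Formula} : (∀ g ∈ S, Derivable Q₁ Q₂ g) → Step Q₁ Q₂ S f →
      (∀ t ∈ f.terms, t ∈ Q₁.terms ++ Q₂.terms) → Derivable Q₁ Q₂ f

end ProofSystem

section Soundness

variable {D : Type*} [LinearOrder D] {ι : ℚ ↪o D} {v : ℕ → D} {Q₁ Q₂ : Query} {S : Set Formula}

variable (ι v) in
/-- Truth of a formula under an assignment. -/
def Formula.Holds : Formula → Prop
  | .bot => False
  | .le a b => a.eval ι v ≤ b.eval ι v
  | .ne a b => a.eval ι v ≠ b.eval ι v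

theorem CompOp.forall_formulas_holds_iff {op : CompOp} {a b : Term} :
    (∀ f ∈ op.formulas a b, f.Holds ι v) ↔ op.Rel (a.eval ι v) (b.eval ι v) := by
  cases op <;> simp only [CompOp.formulas, List.forall_mem_cons, List.not_mem_nil,
    IsEmpty.forall_iff, implies_true, and_true, Formula.Holds,
    CompOp.Rel, gt_iff_lt, ge_iff_le, lt_iff_le_and_ne, le_antisymm_iff]

theorem CompOp.neg_rel_iff {op : CompOp} {x y : D} : op.neg.Rel x y ↔ ¬ op.Rel x y := by
  cases op <;> simp [CompOp.neg, CompOp.Rel]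

theorem Term.eval_subst (σ : ℕ → Term) (t : Term) :
    (t.subst σ).eval ι v = t.eval ι fun n => (σ n).eval ι v := by
  cases t <;> rfl

theorem AC.forall_formulas_holds_iff {c : AC} :
    (∀ f ∈ c.op.formulas (.var c.lhs) c.rhs, f.Holds ι v) ↔ c.Holds ι v :=
  CompOp.forall_formulas_holds_iff

theorem AC.forall_image_holds_iff {σ : ℕ → Term} {c : AC} :
    (∀ f ∈ c.image σ, f.Holds ι v) ↔ c.Holds ι fun n => (σ n).eval ι v := by
  rw [AC.image, CompOp.forall_formulas_holds_iff, Term.eval_subst, AC.Holds]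

variable (ι v) in
/-- The canonical database of `Q` under the assignment `v`. -/
def Query.canonical (Q : Query) : Set (Fact D) :=
  {φ | ∃ a ∈ Q.body, a.fact ι v = φ}

theorem contained_iff_forall_canonical : Q₂.Contained ι Q₁ ↔
    ∀ v : ℕ → D, (∀ a ∈ Q₂.acs, a.Holds ι v) →
      Q₂.head.map (Term.eval ι v) ∈ Q₁.answer ι (Q₂.canonical ι v) := by
  constructor
  · intro h v hv
    refine h _ ?_ ⟨v, fun a ha => ⟨a, ha, rfl⟩, hv, rfl⟩
    exact (List.finite_toSet Q₂.body).image (Atom.fact ι v)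
  · rintro h db - t ⟨v, hbody, hv, rfl⟩
    obtain ⟨w, hw, hacs, hhead⟩ := h v hv
    refine ⟨w, fun a ha => ?_, hacs, hhead⟩
    obtain ⟨b, hb, e⟩ := hw a ha
    exact e ▸ hbody b hb

theorem Equated.eval_eq {a b : Term} (h : Equated S a b) (hS : ∀ f ∈ S, f.Holds ι v) :
    a.eval ι v = b.eval ι v :=
  le_antisymm (hS _ h.1) (hS _ h.2)

theorem map_eval_eq_of_forall₂_equated {σ : ℕ → Term} {s t : List Term}
    (h : List.Forall₂ (fun a b => Equated S (a.subst σ) b) s t) (hS : ∀ f ∈ S, f.Holds ι v) :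
    s.map (Term.eval ι fun n => (σ n).eval ι v) = t.map (Term.eval ι v) := by
  induction h with
  | nil => rfl
  | cons hab _ ih => simp only [List.map_cons, ih, ← Term.eval_subst, hab.eval_eq hS]

theorem IsMapping.mem_answer {σ : ℕ → Term} (h : IsMapping Q₁ Q₂ S σ)
    (hS : ∀ f ∈ S, f.Holds ι v) (hacs : ∀ c ∈ Q₁.acs, ∀ f ∈ c.image σ, f.Holds ι v) :
    Q₂.head.map (Term.eval ι v) ∈ Q₁.answer ι (Q₂.canonical ι v) := by
  refine ⟨fun n => (σ n).eval ι v, fun a ha => ?_,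
    fun c hc => AC.forall_image_holds_iff.1 (hacs c hc),
    (map_eval_eq_of_forall₂_equated h.head hS).symm⟩
  obtain ⟨b, hb, hrel, hargs⟩ := h.body a ha
  exact ⟨b, hb, Prod.ext hrel.symm (map_eval_eq_of_forall₂_equated hargs hS).symm⟩

theorem Step.holds {f : Formula} (h : Step Q₁ Q₂ S f) (hS : ∀ g ∈ S, g.Holds ι v)
    (hv : ∀ c ∈ Q₂.acs, c.Holds ι v)
    (hno : Q₂.head.map (Term.eval ι v) ∉ Q₁.answer ι (Q₂.canonical ι v)) : f.Holds ι v := by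
  cases h with
  | comparison hc hf => exact AC.forall_formulas_holds_iff.2 (hv _ hc) _ hf
  | const_le h => exact ι.monotone h
  | const_ne h => exact ι.injective.ne h
  | refl a => exact le_rfl
  | trans hab hbc => exact le_trans (hS _ hab) (hS _ hbc)
  | @ne_between a b u w huw hau hub haw hwb =>
    intro hab
    have between_eq {x : Term} (hax : .le a x ∈ S) (hxb : .le x b ∈ S) :
        a.eval ι v = x.eval ι v :=
      le_antisymm (hS (.le a x) hax) (le_trans (hS (.le x b) hxb) hab.ge)
    exact hS _ huw ((between_eq hau hub).symm.trans (between_eq haw hwb))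
  | contradiction h => exact (hS _ h rfl).elim
  | mapping_bot hσ hacs => exact hno (hσ.mem_answer hS fun c hc f hf => hS f (hacs c hc f hf))
  | @mapping_neg σ c f hσ hc _ hacs hf =>
    have hneg : ¬ ∀ g ∈ c.image σ, g.Holds ι v := fun hcv =>
      hno (hσ.mem_answer hS fun c' hc' g hg => by
        by_cases hcc : c' = c
        · exact hcv g (hcc ▸ hg)
        · exact hS g (hacs c' hc' hcc g hg))
    rw [AC.image, CompOp.forall_formulas_holds_iff, ← CompOp.neg_rel_iff,
      ← CompOp.forall_formulas_holds_iff] at hneg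
    exact hneg f hf

theorem Derivable.holds {f : Formula} (h : Derivable Q₁ Q₂ f) (hv : ∀ c ∈ Q₂.acs, c.Holds ι v)
    (hno : Q₂.head.map (Term.eval ι v) ∉ Q₁.answer ι (Q₂.canonical ι v)) : f.Holds ι v := by
  induction h with
  | step _ hstep _ ih => exact hstep.holds ih hv hno

theorem contained_of_derivable_bot (h : Derivable Q₁ Q₂ .bot) : Q₂.Contained ι Q₁ :=
  contained_iff_forall_canonical.2 fun _ hv => by_contra fun hno => h.holds hv hno

end Soundness

/-! ### Models of consistent theories -/

section OrderTheory

/-- `S` is a consistent set of formulas with terms in `T` that contains the diagram of the constants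
in `T` and is closed under the laws of linear orders. -/
structure IsOrderTheory (T : List Term) (S : Set Formula) : Prop where
  mem : ∀ f ∈ S, ∀ t ∈ f.terms, t ∈ T
  le_refl : ∀ a ∈ T, .le a a ∈ S
  le_trans : ∀ a b c, .le a b ∈ S → .le b c ∈ S → .le a c ∈ S
  ne_of_between : ∀ a b u w, .ne u w ∈ S → .le a u ∈ S → .le u b ∈ S → .le a w ∈ S →
    .le w b ∈ S → .ne a b ∈ S
  const_le : ∀ c d : ℚ, .const c ∈ T → .const d ∈ T → c ≤ d → .le (.const c) (.const d) ∈ S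
  const_ne : ∀ c d : ℚ, .const c ∈ T → .const d ∈ T → c ≠ d → .ne (.const c) (.const d) ∈ S
  ne_irrefl : ∀ a, .ne a a ∉ S

/-- `P` pins terms `y` to constants `c` for which `y ≤ c`, but not `y ≠ c`, is in `S`. -/
def IsPinning (S : Set Formula) (P : Term → ℚ → Prop) : Prop :=
  ∀ y c, P y c → .le y (.const c) ∈ S ∧ .ne y (.const c) ∉ S

/-- The order of `S`, extended by `c ≤ y` for all terms `y` that `P` pins to the constant `c`. -/
def Pinned (S : Set Formula) (P : Term → ℚ → Prop) (a b : Term) : Prop :=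
  .le a b ∈ S ∨ ∃ c y, P y c ∧ .le a (.const c) ∈ S ∧ .le y b ∈ S

namespace IsOrderTheory

variable {T : List Term} {S : Set Formula} {P : Term → ℚ → Prop} {a b y z : Term} {c d : ℚ}

theorem mem_left (h : IsOrderTheory T S) (hab : .le a b ∈ S) : a ∈ T :=
  h.mem _ hab a (by simp [Formula.terms])

theorem mem_right (h : IsOrderTheory T S) (hab : .le a b ∈ S) : b ∈ T :=
  h.mem _ hab b (by simp [Formula.terms])

theorem ne_symm (h : IsOrderTheory T S) (hab : .ne a b ∈ S) (hba : .le b a ∈ S) : .ne b a ∈ S :=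
  h.ne_of_between b a a b hab hba (h.le_refl a (h.mem_right hba)) (h.le_refl b (h.mem_left hba)) hba

theorem const_le_iff (h : IsOrderTheory T S) (hc : .const c ∈ T) (hd : .const d ∈ T) :
    .le (.const c) (.const d) ∈ S ↔ c ≤ d := by
  refine ⟨fun hle => ?_, h.const_le c d hc hd⟩
  by_contra! hlt
  exact h.ne_irrefl _ (h.ne_of_between _ _ _ _ (h.const_ne c d hc hd hlt.ne')
    (h.le_refl _ hc) (h.le_refl _ hc) hle (h.const_le d c hd hc hlt.le))

theorem const_eq_of_between (h : IsOrderTheory T S) (hn : .ne y (.const c) ∉ S)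
    (hyd : .le y (.const d) ∈ S) (hdc : .le (.const d) (.const c) ∈ S) : d = c := by
  by_contra hne
  have hc := h.mem_right hdc
  exact hn (h.ne_of_between _ _ _ _ (h.const_ne d c (h.mem_left hdc) hc hne) hyd hdc
    (h.le_trans _ _ _ hyd hdc) (h.le_refl _ hc))

theorem pinned_const_eq (h : IsOrderTheory T S) (hP : IsPinning S P) (hy : P y c) (hz : P z d)
    (hyd : .le y (.const d) ∈ S) (hzc : .le z (.const c) ∈ S) : c = d := by
  have hc := h.mem_right hzc
  have hd := h.mem_right hyd
  rcases le_total c d with hle | hle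
  · exact h.const_eq_of_between (hP z d hz).2 hzc (h.const_le c d hc hd hle)
  · exact (h.const_eq_of_between (hP y c hy).2 hyd (h.const_le d c hd hc hle)).symm

theorem pinned_trans (h : IsOrderTheory T S) (hP : IsPinning S P) {e : Term}
    (hab : Pinned S P a b) (hbe : Pinned S P b e) : Pinned S P a e := by
  rcases hab with hab | ⟨c, y, hy, hac, hyb⟩ <;> rcases hbe with hbe | ⟨d, z, hz, hbd, hze⟩
  · exact .inl (h.le_trans _ _ _ hab hbe)
  · exact .inr ⟨d, z, hz, h.le_trans _ _ _ hab hbd, hze⟩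
  · exact .inr ⟨c, y, hy, hac, h.le_trans _ _ _ hyb hbe⟩
  · have hc := h.mem_right hac
    have hd := h.mem_right hbd
    rcases le_total c d with hle | hle
    · exact .inr ⟨d, z, hz, h.le_trans _ _ _ hac (h.const_le c d hc hd hle), hze⟩
    · obtain rfl := h.const_eq_of_between (hP y c hy).2 (h.le_trans _ _ _ hyb hbd)
        (h.const_le d c hd hc hle)
      exact .inr ⟨d, z, hz, hac, hze⟩

theorem le_const_of_pinned (h : IsOrderTheory T S) (hP : IsPinning S P) (hd : .const d ∈ T)
    (had : Pinned S P a (.const d)) : .le a (.const d) ∈ S := by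
  rcases had with had | ⟨c, y, hy, hac, hyd⟩
  · exact had
  · have hc := h.mem_right hac
    rcases le_total c d with hle | hle
    · exact h.le_trans _ _ _ hac (h.const_le c d hc hd hle)
    · rwa [h.const_eq_of_between (hP y c hy).2 hyd (h.const_le d c hd hc hle)]

theorem not_pinned_of_lt (h : IsOrderTheory T S) (hP : IsPinning S P) (hab : .le a b ∈ S)
    (hne : .ne a b ∈ S) : ¬ Pinned S P b a := by
  have ha := h.mem_left hab
  rintro (hba | ⟨c, y, hy, hbc, hya⟩)
  · exact h.ne_irrefl a
      (h.ne_of_between _ _ _ _ hne (h.le_refl a ha) (h.le_refl a ha) hab hba)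
  · exact (hP y c hy).2 (h.ne_of_between _ _ _ _ hne hya (h.le_trans _ _ _ hab hbc)
      (h.le_trans _ _ _ hya hab) hbc)

end IsOrderTheory

section Models

variable {D : Type*} [LinearOrder D] (ι : ℚ ↪o D)

/-- A model of `S` and of the order extended by the pinned terms, in which equalities and
inequalities `a ≤ c` with constants `c` only hold if they have to. -/
structure IsPinnedModel (T : List Term) (S : Set Formula) (P : Term → ℚ → Prop) (v : ℕ → D) :
    Prop where
  mono : ∀ a ∈ T, ∀ b ∈ T, Pinned S P a b → a.eval ι v ≤ b.eval ι v
  pinned_of_eq : ∀ a ∈ T, ∀ b ∈ T, a.eval ι v = b.eval ι v → Pinned S P a b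
  le_const : ∀ a ∈ T, ∀ c : ℚ, .const c ∈ T → a.eval ι v ≤ ι c → .le a (.const c) ∈ S

variable {ι} {T : List Term} {S : Set Formula} {P : Term → ℚ → Prop} {v : ℕ → D} {a b : Term}

variable (ι) in
theorem IsOrderTheory.exists_isPinnedModel [DenselyOrdered D] [NoMinOrder D] [NoMaxOrder D]
    (h : IsOrderTheory T S) (hP : IsPinning S P) : ∃ v : ℕ → D, IsPinnedModel ι T S P v := by
  classical
  let _ : Preorder {t // t ∈ T} :=
    { le := fun a b => Pinned S P a b
      le_refl := fun a => .inl (h.le_refl a a.2)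
      le_trans := fun _ _ _ => h.pinned_trans hP }
  have : Finite {t // t ∈ T} := T.finite_toSet.to_subtype
  obtain ⟨g, hmono, hgK, hinj, hconst⟩ := exists_generic_monotone
    (K := {t : {t // t ∈ T} | ∃ c, t.1 = .const c}) (f := fun t => t.1.eval ι fun _ => ι 0) (by
      rintro ⟨_, hc⟩ ⟨c, rfl⟩ ⟨_, hd⟩ ⟨d, rfl⟩
      rw [Term.eval, Term.eval, ι.le_iff_le, ← h.const_le_iff hc hd]
      exact ⟨.inl, h.le_const_of_pinned hP hd⟩)
  let v : ℕ → D := fun n => if hn : .var n ∈ T then g ⟨.var n, hn⟩ else ι 0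
  have hv : ∀ t (ht : t ∈ T), t.eval ι v = g ⟨t, ht⟩ := by
    rintro (n | c) ht
    · simp only [Term.eval, v, dif_pos ht]
    · exact (hgK (x := ⟨.const c, ht⟩) ⟨c, rfl⟩).symm
  refine ⟨v, fun a ha b hb hab => ?_, fun a ha b hb hab => ?_, fun a ha c hc hac => ?_⟩
  · rw [hv a ha, hv b hb]
    exact hmono hab
  · rw [hv a ha, hv b hb] at hab
    exact hinj _ _ hab
  · rw [← Term.eval.eq_2 ι v c, hv a ha, hv _ hc] at hac
    exact h.le_const_of_pinned hP hc (hconst ⟨a, ha⟩ ⟨.const c, hc⟩ ⟨c, rfl⟩ hac)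

namespace IsPinnedModel

theorem eval_le (hm : IsPinnedModel ι T S P v) (h : IsOrderTheory T S) (hab : .le a b ∈ S) :
    a.eval ι v ≤ b.eval ι v :=
  hm.mono a (h.mem_left hab) b (h.mem_right hab) (.inl hab)

theorem const_le_eval (hm : IsPinnedModel ι T S P v) (h : IsOrderTheory T S) (hP : IsPinning S P)
    {c : ℚ} (ha : a ∈ T) (hac : P a c) : ι c ≤ a.eval ι v := by
  have hc := h.mem_right (hP a c hac).1
  exact hm.mono (.const c) hc a ha (.inr ⟨c, a, hac, h.le_refl _ hc, h.le_refl a ha⟩)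

theorem eval_lt (hm : IsPinnedModel ι T S P v) (h : IsOrderTheory T S) (hP : IsPinning S P)
    (hab : .le a b ∈ S) (hne : .ne a b ∈ S) : a.eval ι v < b.eval ι v :=
  (hm.eval_le h hab).lt_of_ne fun e => h.not_pinned_of_lt hP hab hne
    (hm.pinned_of_eq b (h.mem_right hab) a (h.mem_left hab) e.symm)

theorem rel_of_formulas_subset (hm : IsPinnedModel ι T S P v) (h : IsOrderTheory T S)
    (hP : IsPinning S P) {op : CompOp} (hop : op ≠ .ne) (hS : ∀ f ∈ op.formulas a b, f ∈ S) :
    op.Rel (a.eval ι v) (b.eval ι v) := by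
  cases op <;> simp only [CompOp.formulas, List.forall_mem_cons, List.not_mem_nil,
    IsEmpty.forall_iff, implies_true, and_true] at hS
  case lt => exact hm.eval_lt h hP hS.1 hS.2
  case le => exact hm.eval_le h hS
  case gt => exact hm.eval_lt h hP hS.1 hS.2
  case ge => exact hm.eval_le h hS
  case eq => exact le_antisymm (hm.eval_le h hS.1) (hm.eval_le h hS.2)
  case ne => exact absurd rfl hop

theorem exists_pins_of_eval_eq (hm : IsPinnedModel ι T S P v) (h : IsOrderTheory T S)
    (hP : IsPinning S P) (hne : .ne a b ∈ S) (e : a.eval ι v = b.eval ι v) :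
    ∃ c y z, P y c ∧ P z c ∧ .le y a ∈ S ∧ .le a (.const c) ∈ S ∧
      .le z b ∈ S ∧ .le b (.const c) ∈ S := by
  have ha : a ∈ T := h.mem _ hne a (by simp [Formula.terms])
  have hb : b ∈ T := h.mem _ hne b (by simp [Formula.terms])
  have hab := hm.pinned_of_eq a ha b hb e
  have hba := hm.pinned_of_eq b hb a ha e.symm
  rcases id hab with hle | ⟨c, z, hz, hac, hzb⟩
  · exact absurd hba (h.not_pinned_of_lt hP hle hne)
  rcases id hba with hle | ⟨d, y, hy, hbd, hya⟩
  · exact absurd hab (h.not_pinned_of_lt hP hle (h.ne_symm hne hle))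
  obtain rfl : c = d :=
    h.pinned_const_eq hP hz hy (h.le_trans _ _ _ hzb hbd) (h.le_trans _ _ _ hya hac)
  exact ⟨c, y, z, hy, hz, hya, hac, hzb, hbd⟩

theorem eval_ne_const (hm : IsPinnedModel ι T S P v) (h : IsOrderTheory T S)
    (hP : IsPinning S P) {k : ℚ} (hne : .ne a (.const k) ∈ S) : a.eval ι v ≠ ι k := by
  intro e
  obtain ⟨c, y, z, -, hz, -, hac, hzk, hkc⟩ :=
    hm.exists_pins_of_eval_eq h hP (b := .const k) hne e
  obtain rfl := h.const_eq_of_between (hP z c hz).2 hzk hkc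
  exact (hm.eval_lt h hP hac hne).ne e

end IsPinnedModel

end Models

end OrderTheory

/-! ### Completeness -/

section Completeness

variable {Q₁ Q₂ : Query} {a b c t : Term} {f : Formula}

theorem CompOp.eq_or_eq_of_mem_formulas {op : CompOp} (hf : f ∈ op.formulas a b)
    (ht : t ∈ f.terms) : t = a ∨ t = b := by
  cases op <;> simp only [CompOp.formulas, List.mem_cons, List.not_mem_nil, or_false] at hf
  case lt | gt | eq => rcases hf with rfl | rfl <;> simpa [Formula.terms, or_comm] using ht
  all_goals subst hf; simpa [Formula.terms, or_comm] using ht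

theorem Query.lhs_mem_terms {Q : Query} {e : AC} (he : e ∈ Q.acs) : .var e.lhs ∈ Q.terms :=
  List.mem_append_right _ (List.mem_flatMap.2 ⟨e, he, by simp⟩)

theorem Query.rhs_mem_terms {Q : Query} {e : AC} (he : e ∈ Q.acs) : e.rhs ∈ Q.terms :=
  List.mem_append_right _ (List.mem_flatMap.2 ⟨e, he, by simp⟩)

theorem Query.mem_terms_of_mem_head {Q : Query} (ht : t ∈ Q.head) : t ∈ Q.terms :=
  List.mem_append_left _ (List.mem_append_left _ ht)

theorem Query.mem_terms_of_mem_args {Q : Query} {e : Atom} (he : e ∈ Q.body) (ht : t ∈ e.args) :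
    t ∈ Q.terms :=
  List.mem_append_left _ (List.mem_append_right _ (List.mem_flatMap.2 ⟨e, he, ht⟩))

/-- The set of all derivable formulas. -/
abbrev Theory (Q₁ Q₂ : Query) : Set Formula := {f | Derivable Q₁ Q₂ f}

namespace Derivable

theorem mem_terms (h : Derivable Q₁ Q₂ f) : ∀ t ∈ f.terms, t ∈ Q₁.terms ++ Q₂.terms := by
  cases h
  assumption

theorem of_step (h : Step Q₁ Q₂ (Theory Q₁ Q₂) f)
    (hf : ∀ t ∈ f.terms, t ∈ Q₁.terms ++ Q₂.terms) : Derivable Q₁ Q₂ f :=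
  .step (fun _ => id) h hf

theorem of_mem_formulas {e : AC} (he : e ∈ Q₂.acs) (hf : f ∈ e.op.formulas (.var e.lhs) e.rhs) :
    Derivable Q₁ Q₂ f :=
  of_step (.comparison he hf) fun t ht => by
    rcases CompOp.eq_or_eq_of_mem_formulas hf ht with rfl | rfl
    · exact List.mem_append_right _ (Query.lhs_mem_terms he)
    · exact List.mem_append_right _ (Query.rhs_mem_terms he)

theorem le_refl (ha : a ∈ Q₁.terms ++ Q₂.terms) : Derivable Q₁ Q₂ (.le a a) :=
  of_step (.refl a) (by simpa only [Formula.terms, List.forall_mem_cons, List.not_mem_nil,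
    IsEmpty.forall_iff, implies_true, and_true, and_self] using ha)

theorem left_mem_terms (h : Derivable Q₁ Q₂ (.le a b)) : a ∈ Q₁.terms ++ Q₂.terms :=
  h.mem_terms a (by simp [Formula.terms])

theorem right_mem_terms (h : Derivable Q₁ Q₂ (.le a b)) : b ∈ Q₁.terms ++ Q₂.terms :=
  h.mem_terms b (by simp [Formula.terms])

theorem le_trans (hab : Derivable Q₁ Q₂ (.le a b)) (hbc : Derivable Q₁ Q₂ (.le b c)) :
    Derivable Q₁ Q₂ (.le a c) :=
  of_step (.trans hab hbc) (by simp [Formula.terms, -List.mem_append, hab.left_mem_terms,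
    hbc.right_mem_terms])

theorem ne_of_between {u w : Term} (huw : Derivable Q₁ Q₂ (.ne u w))
    (hau : Derivable Q₁ Q₂ (.le a u)) (hub : Derivable Q₁ Q₂ (.le u b))
    (haw : Derivable Q₁ Q₂ (.le a w)) (hwb : Derivable Q₁ Q₂ (.le w b)) :
    Derivable Q₁ Q₂ (.ne a b) :=
  of_step (.ne_between huw hau hub haw hwb) (by simp [Formula.terms, -List.mem_append,
    hau.left_mem_terms, hub.right_mem_terms])

end Derivable

theorem isOrderTheory_derivable (h : ¬ Derivable Q₁ Q₂ .bot) :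
    IsOrderTheory (Q₁.terms ++ Q₂.terms) (Theory Q₁ Q₂) where
  mem _ hf := hf.mem_terms
  le_refl _ ha := Derivable.le_refl ha
  le_trans _ _ _ hab hbc := Derivable.le_trans hab hbc
  ne_of_between _ _ _ _ huw hau hub haw hwb := Derivable.ne_of_between huw hau hub haw hwb
  const_le _ _ hc hd hcd := .of_step (.const_le hcd) (by
    simp [Formula.terms, -List.mem_append, hc, hd])
  const_ne _ _ hc hd hcd := .of_step (.const_ne hcd) (by
    simp [Formula.terms, -List.mem_append, hc, hd])
  ne_irrefl _ ha := h (.of_step (.contradiction ha) (by simp [Formula.terms]))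

/-- All comparisons of `Q` are semi-interval comparisons, and at most one of them is an RSI. -/
structure Query.IsSemiInterval (Q : Query) : Prop where
  op : ∀ e ∈ Q.acs, e.op = .le ∨ e.op = .lt ∨ e.IsRSI
  rhs_const : ∀ e ∈ Q.acs, ∃ d, e.rhs = .const d
  rsi_unique : ∀ e ∈ Q.acs, ∀ e' ∈ Q.acs, e.IsRSI → e'.IsRSI → e = e'

section ClosedLSI

variable {D : Type*} [LinearOrder D] {ι : ℚ ↪o D}

/-- `a ≤ b` is obtained from the negation of a comparison of `Q₁` that is an RSI, hence of the
form `t < d` or `t ≤ d`. -/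
def DerivableViaRSI (Q₁ Q₂ : Query) (a b : Term) : Prop :=
  ∃ e ∈ Q₁.acs, e.IsRSI ∧ Derivable Q₁ Q₂ (.le a e.rhs) ∧
    (e.op = .ge → Derivable Q₁ Q₂ (.ne a e.rhs)) ∧ Derivable Q₁ Q₂ (.le e.rhs b)

theorem DerivableViaRSI.of_mapping {S : Set Formula} {σ : ℕ → Term} {e : AC}
    (hcl : Q₁.IsSemiInterval) (hS : ∀ g ∈ S, Derivable Q₁ Q₂ g) (hσ : IsMapping Q₁ Q₂ S σ)
    (he : e ∈ Q₁.acs) (hrsi : e.IsRSI)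
    (hacs : ∀ e' ∈ Q₁.acs, e' ≠ e → ∀ g ∈ e'.image σ, g ∈ S)
    (hab : .le a b ∈ e.op.neg.formulas (σ e.lhs) (e.rhs.subst σ)) :
    DerivableViaRSI Q₁ Q₂ a b := by
  have hrhs : e.rhs.subst σ = e.rhs := by
    obtain ⟨d, hd⟩ := hcl.rhs_const e he
    rw [hd, Term.subst]
  rw [hrhs] at hab
  have derivable {g : Formula} (hg : g ∈ e.op.neg.formulas (σ e.lhs) e.rhs) :
      Derivable Q₁ Q₂ g := by
    refine .step hS (.mapping_neg hσ he hrsi hacs (hrhs.symm ▸ hg)) fun t ht => ?_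
    rcases CompOp.eq_or_eq_of_mem_formulas hg ht with rfl | rfl
    · exact hσ.terms _ (Query.lhs_mem_terms he)
    · exact List.mem_append_left _ (Query.rhs_mem_terms he)
  have hle : a = σ e.lhs ∧ b = e.rhs := by
    rcases hrsi with hop | hop <;> simpa [hop, CompOp.neg, CompOp.formulas] using hab
  obtain ⟨rfl, rfl⟩ := hle
  refine ⟨e, he, hrsi, derivable hab, fun hge => derivable ?_,
    Derivable.le_refl (List.mem_append_left _ (Query.rhs_mem_terms he))⟩
  simp [hge, CompOp.neg, CompOp.formulas]

theorem DerivableViaRSI.trans_left (hab : Derivable Q₁ Q₂ (.le a b))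
    (hbc : DerivableViaRSI Q₁ Q₂ b c) : DerivableViaRSI Q₁ Q₂ a c := by
  obtain ⟨e, he, hrsi, hbe, hne, hec⟩ := hbc
  exact ⟨e, he, hrsi, hab.le_trans hbe, fun hge => (hne hge).ne_of_between hab hbe
    (hab.le_trans hbe) (Derivable.le_refl hec.left_mem_terms), hec⟩

variable (ι) in
theorem Derivable.holds_or_viaRSI (hcl : Q₁.IsSemiInterval) (hab : Derivable Q₁ Q₂ (.le a b)) :
    (∀ v : ℕ → D, (∀ e ∈ Q₂.acs, e.Holds ι v) → a.eval ι v ≤ b.eval ι v) ∨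
      DerivableViaRSI Q₁ Q₂ a b := by
  generalize hf : Formula.le a b = f at hab
  induction hab generalizing a b with
  | step hS hstep _ ih =>
    subst hf
    cases hstep with
    | comparison he hmem =>
      exact .inl fun v hv => AC.forall_formulas_holds_iff.2 (hv _ he) _ hmem
    | const_le h => exact .inl fun _ _ => ι.monotone h
    | refl => exact .inl fun _ _ => _root_.le_rfl
    | trans hab hbc =>
      rcases ih _ hbc rfl with hbc' | hbc'
      · rcases ih _ hab rfl with hab' | ⟨e, he, hrsi, hae, hne, heb⟩
        · exact .inl fun v hv => (hab' v hv).trans (hbc' v hv)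
        · exact .inr ⟨e, he, hrsi, hae, hne, heb.le_trans (hS _ hbc)⟩
      · exact .inr (.trans_left (hS _ hab) hbc')
    | mapping_neg hσ he hrsi hacs hmem => exact .inr (.of_mapping hcl hS hσ he hrsi hacs hmem)

theorem forall_acs_holds_of_isPinnedModel {P : Term → ℚ → Prop} {v : ℕ → D}
    (h : ¬ Derivable Q₁ Q₂ .bot) (hP : IsPinning (Theory Q₁ Q₂) P)
    (hm : IsPinnedModel ι (Q₁.terms ++ Q₂.terms) (Theory Q₁ Q₂) P v)
    (hne : ∀ X Y, ⟨X, .ne, .var Y⟩ ∈ Q₂.acs → ∀ d y z, P y d → P z d →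
      Derivable Q₁ Q₂ (.le y (.var X)) → Derivable Q₁ Q₂ (.le (.var X) (.const d)) →
      Derivable Q₁ Q₂ (.le z (.var Y)) → ¬ Derivable Q₁ Q₂ (.le (.var Y) (.const d))) :
    ∀ e ∈ Q₂.acs, e.Holds ι v := by
  have hT := isOrderTheory_derivable h
  rintro ⟨X, op, t⟩ he
  have hS : ∀ f ∈ op.formulas (.var X) t, f ∈ Theory Q₁ Q₂ :=
    fun f => Derivable.of_mem_formulas he
  by_cases hop : op = .ne
  · subst hop
    have hXt := hS _ (List.mem_singleton_self _)
    cases t with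
    | const d => exact hm.eval_ne_const hT hP hXt
    | var Y =>
      intro e
      obtain ⟨d, y, z, hy, hz, hyX, hXd, hzY, hYd⟩ := hm.exists_pins_of_eval_eq hT hP hXt e
      exact hne X Y he d y z hy hz hyX hXd hzY hYd
  · exact hm.rel_of_formulas_subset hT hP hop hS

variable [DenselyOrdered D] [NoMinOrder D] [NoMaxOrder D]

theorem closedLSI_of_derivable (h : ¬ Derivable Q₁ Q₂ .bot) (hcl : Q₁.IsSemiInterval) {X : ℕ}
    {d : ℚ} (hle : Derivable Q₁ Q₂ (.le (.var X) (.const d)))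
    (hne : ¬ Derivable Q₁ Q₂ (.ne (.var X) (.const d)))
    (hge : ¬ Derivable Q₁ Q₂ (.le (.const d) (.var X))) (hd : ¬ Q₁.OpenRSIConst d) :
    ClosedLSI ι Q₂.acs X d := by
  have hT := isOrderTheory_derivable h
  refine ⟨?_, fun hlt => ?_, fun heq => ?_⟩
  · rcases hle.holds_or_viaRSI ι hcl with himp | ⟨e, he, hrsi, hXe, hen, hed⟩
    · exact himp
    · obtain ⟨k, hk⟩ := hcl.rhs_const e he
      rw [hk] at hXe hen hed
      obtain rfl := hT.const_eq_of_between hne hXe hed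
      rcases hrsi with hop | hop
      · exact absurd (hen hop) hne
      · exact absurd ⟨e.lhs, by rw [← hk, ← hop]; exact he⟩ hd
  · have hP : IsPinning (Theory Q₁ Q₂) fun y k => y = .var X ∧ k = d := by
      rintro y k ⟨rfl, rfl⟩
      exact ⟨hle, hne⟩
    obtain ⟨v, hm⟩ := hT.exists_isPinnedModel ι hP
    refine (hlt v (forall_acs_holds_of_isPinnedModel h hP hm ?_)).not_ge
      (hm.const_le_eval hT hP hle.left_mem_terms ⟨rfl, rfl⟩)
    rintro Y Z hYZ k y z ⟨rfl, rfl⟩ ⟨rfl, -⟩ hXY hYd hXZ hZd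
    exact hne ((Derivable.of_mem_formulas hYZ (List.mem_singleton_self _)).ne_of_between
      hXY hYd hXZ hZd)
  · have hP : IsPinning (Theory Q₁ Q₂) fun _ _ => False := fun _ _ => False.elim
    obtain ⟨v, hm⟩ := hT.exists_isPinnedModel ι hP
    have e := heq v (forall_acs_holds_of_isPinnedModel h hP hm fun _ _ _ _ _ _ => False.elim)
    rcases hm.pinned_of_eq _ hle.right_mem_terms _ hle.left_mem_terms e.symm with hdX | ⟨_, _, h, _⟩
    exacts [hge hdX, h]

end ClosedLSI

end Completeness

section Completeness

variable {D : Type*} [LinearOrder D] {ι : ℚ ↪o D} {v w : ℕ → D} {Q₁ Q₂ : Query}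
  {S : Set Formula}

theorem exists_map_eq_of_nodup {α β : Type*} (f₀ : α → β) {xs : List α}
    (hxs : xs.Nodup) {ys : List β} (hlen : xs.length = ys.length) :
    ∃ f : α → β, xs.map f = ys ∧ ∀ x ∉ xs, f x = f₀ x := by
  classical
  induction hxs generalizing ys with
  | nil => exact ⟨f₀, by simpa using hlen.symm, fun _ _ => rfl⟩
  | @cons x xs hx _ ih =>
    obtain _ | ⟨y, ys⟩ := ys
    · simp at hlen
    obtain ⟨f, hf, hf₀⟩ := ih (Nat.succ.inj hlen)
    refine ⟨Function.update f x y, ?_, fun z hz => ?_⟩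
    · rw [List.map_cons, Function.update_self, List.map_congr_left fun z hz =>
        Function.update_of_ne (hx z hz).symm y f, hf]
    · rw [List.mem_cons, not_or] at hz
      rw [Function.update_of_ne hz.1, hf₀ z hz.2]

theorem forall_eq_of_flatMap_eq {α β : Type*} {l : List α} {f g : α → List β}
    (hlen : ∀ a ∈ l, (f a).length = (g a).length) (h : l.flatMap f = l.flatMap g) :
    ∀ a ∈ l, f a = g a := by
  induction l with
  | nil => simp
  | cons a l ih =>
    rw [List.forall_mem_cons] at hlen ⊢
    rw [List.flatMap_cons, List.flatMap_cons] at h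
    obtain ⟨h₁, h₂⟩ := List.append_inj h hlen.1
    exact ⟨h₁, ih hlen.2 h₂⟩

theorem forall₂_of_map_eq {α β γ : Type*} {f : α → γ} {g : β → γ} {R : α → β → Prop}
    {s : List α} {t : List β} (h : s.map f = t.map g)
    (hR : ∀ a ∈ s, ∀ b ∈ t, f a = g b → R a b) : List.Forall₂ R s t := by
  rw [← List.forall₂_eq_eq_eq, List.forall₂_map_left_iff, List.forall₂_map_right_iff] at h
  induction h with
  | nil => exact .nil
  | cons hab _ ih =>
    exact .cons (hR _ List.mem_cons_self _ List.mem_cons_self hab) (ih fun a ha b hb =>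
      hR a (List.mem_cons_of_mem _ ha) b (List.mem_cons_of_mem _ hb))

theorem exists_map_subst_eq {xs : List ℕ} (hxs : xs.Nodup) {t : List Term}
    (ht : t.map (Term.eval ι v) = xs.map w) :
    ∃ σ : ℕ → Term, (xs.map Term.var).map (Term.subst σ) = t ∧
      (∀ n ∈ xs, (σ n).eval ι v = w n) ∧ ∀ n, σ n ∈ t ∨ σ n = .var n := by
  obtain ⟨σ, hσ, hσ₀⟩ := exists_map_eq_of_nodup Term.var hxs
    (by simpa only [List.length_map] using (congrArg List.length ht).symm)
  refine ⟨σ, by rw [← hσ, List.map_map]; rfl, ?_, fun n => ?_⟩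
  · rw [← hσ, List.map_map] at ht
    exact List.map_inj_left.1 ht
  · by_cases hn : n ∈ xs
    · exact .inl (hσ ▸ List.mem_map_of_mem hn)
    · exact .inr (hσ₀ n hn)

theorem exists_subst_of_equationFree (hfree : Q₁.EquationFree)
    (hbody : ∀ a ∈ Q₁.body, a.fact ι w ∈ Q₂.canonical ι v)
    (hhead : Q₂.head.map (Term.eval ι v) = Q₁.head.map (Term.eval ι w)) :
    ∃ σ : ℕ → Term, Q₁.head.map (Term.subst σ) = Q₂.head ∧
      (∀ a ∈ Q₁.body, ∃ b ∈ Q₂.body, a.rel = b.rel ∧ a.args.map (Term.subst σ) = b.args) ∧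
      (∀ n, Q₁.OccursInBody n → (σ n).eval ι v = w n) ∧
      ∀ n, σ n ∈ Q₂.terms ∨ σ n = .var n := by
  obtain ⟨xs, hnodup, hxs⟩ := hfree
  choose! b hb hbe using hbody
  have hargs : ∀ a ∈ Q₁.body, (b a).args.map (Term.eval ι v) = a.args.map (Term.eval ι w) :=
    fun a ha => congrArg Prod.snd (hbe a ha)
  have hvals : (Q₂.head ++ Q₁.body.flatMap fun a => (b a).args).map (Term.eval ι v) =
      xs.map w := by
    rw [show xs.map w = (xs.map Term.var).map (Term.eval ι w) by rw [List.map_map]; rfl, ← hxs,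
      List.map_append, List.map_append, hhead, List.map_flatMap, List.map_flatMap,
      List.flatMap_congr hargs]
  obtain ⟨σ, hσ, hσw, hσt⟩ := exists_map_subst_eq hnodup hvals
  rw [← hxs, List.map_append, List.map_flatMap] at hσ
  obtain ⟨hσhead, hσbody⟩ := List.append_inj hσ
    (by simpa only [List.length_map] using (congrArg List.length hhead).symm)
  have hσargs := forall_eq_of_flatMap_eq (fun a ha => by
    simpa only [List.length_map] using (congrArg List.length (hargs a ha)).symm) hσbody
  refine ⟨σ, hσhead, fun a ha => ⟨b a, hb a ha, (congrArg Prod.fst (hbe a ha)).symm,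
    hσargs a ha⟩, ?_, fun n => (hσt n).imp_left fun hn => ?_⟩
  · rintro n ⟨a, ha, hn⟩
    have hn' : Term.var n ∈ xs.map Term.var :=
      hxs ▸ List.mem_append_right _ (List.mem_flatMap.2 ⟨a, ha, hn⟩)
    exact hσw n (by simpa using hn')
  · rcases List.mem_append.1 hn with hn | hn
    · exact Query.mem_terms_of_mem_head hn
    · obtain ⟨a, ha, hn⟩ := List.mem_flatMap.1 hn
      exact Query.mem_terms_of_mem_args (hb a ha) hn

theorem exists_isMapping_of_equationFree (hfree : Q₁.EquationFree)
    (hrefl : ∀ t ∈ Q₂.terms, .le t t ∈ S)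
    (hbody : ∀ a ∈ Q₁.body, a.fact ι w ∈ Q₂.canonical ι v)
    (hhead : Q₂.head.map (Term.eval ι v) = Q₁.head.map (Term.eval ι w)) :
    ∃ σ : ℕ → Term, IsMapping Q₁ Q₂ S σ ∧
      ∀ n, Q₁.OccursInBody n → (σ n).eval ι v = w n := by
  obtain ⟨σ, hσhead, hσbody, hσw, hσt⟩ := exists_subst_of_equationFree hfree hbody hhead
  have forall₂_equated {s t : List Term} (hst : s.map (Term.subst σ) = t)
      (ht : ∀ b ∈ t, b ∈ Q₂.terms) : List.Forall₂ (fun a b => Equated S (a.subst σ) b) s t :=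
    forall₂_of_map_eq (g := id) (hst.trans t.map_id.symm) fun a _ b hb hab => by
      obtain rfl : a.subst σ = b := hab
      exact ⟨hrefl _ (ht _ hb), hrefl _ (ht _ hb)⟩
  refine ⟨σ, ⟨?_, forall₂_equated hσhead fun _ => Query.mem_terms_of_mem_head, fun a ha => ?_⟩, hσw⟩
  · rintro (n | c) hs
    · rcases hσt n with h | h
      · exact List.mem_append_right _ h
      · exact List.mem_append_left _ (by rwa [Term.subst, h])
    · exact List.mem_append_left _ hs
  · obtain ⟨b, hb, hrel, hargs⟩ := hσbody a ha
    exact ⟨b, hb, hrel, forall₂_equated hargs fun _ => Query.mem_terms_of_mem_args hb⟩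

theorem exists_subst_eval_eq (ι : ℚ ↪o D) (v w : ℕ → D) (T : List Term) :
    ∃ σ : ℕ → Term, (∀ n, ∀ t ∈ T, t.eval ι v = w n → (σ n).eval ι v = w n) ∧
      ∀ s ∈ T, s.subst σ ∈ T := by
  have hex : ∀ n, ∃ t : Term, (t ∈ T ∧ t.eval ι v = w n) ∨
      (t = .var n ∧ ∀ s ∈ T, s.eval ι v ≠ w n) := by
    intro n
    by_cases h : ∃ t ∈ T, t.eval ι v = w n
    · exact h.imp fun _ => .inl
    · exact ⟨.var n, .inr ⟨rfl, by simpa only [not_exists, not_and] using h⟩⟩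
  choose σ hσ using hex
  refine ⟨σ, fun n t ht htn => (hσ n).elim And.right fun h => absurd htn (h.2 t ht), ?_⟩
  rintro (n | c) hs
  · rcases hσ n with h | h
    · exact h.1
    · rwa [Term.subst, h.1]
  · exact hs

theorem exists_isMapping_of_equated
    (heq : ∀ s ∈ Q₁.terms ++ Q₂.terms, ∀ t ∈ Q₁.terms ++ Q₂.terms,
      s.eval ι v = t.eval ι v → Equated S s t)
    (hbody : ∀ a ∈ Q₁.body, a.fact ι w ∈ Q₂.canonical ι v)
    (hhead : Q₂.head.map (Term.eval ι v) = Q₁.head.map (Term.eval ι w)) :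
    ∃ σ : ℕ → Term, IsMapping Q₁ Q₂ S σ ∧
      ∀ n, Q₁.OccursInBody n → (σ n).eval ι v = w n := by
  obtain ⟨σ, hσw, hT⟩ := exists_subst_eval_eq ι v w (Q₁.terms ++ Q₂.terms)
  have hterms : ∀ s ∈ Q₁.terms, s.subst σ ∈ Q₁.terms ++ Q₂.terms :=
    fun s hs => hT s (List.mem_append_left _ hs)
  have forall₂_equated {s t : List Term} (hs : ∀ a ∈ s, a ∈ Q₁.terms) (ht : ∀ b ∈ t, b ∈ Q₂.terms)
      (hst : t.map (Term.eval ι v) = s.map (Term.eval ι w)) :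
      List.Forall₂ (fun a b => Equated S (a.subst σ) b) s t := by
    refine forall₂_of_map_eq hst.symm fun a ha b hb hab => ?_
    have hb' := List.mem_append_right Q₁.terms (ht b hb)
    refine heq _ (hterms a (hs a ha)) b hb' (Eq.trans ?_ hab)
    cases a
    · exact hσw _ b hb' hab.symm
    · rfl
  refine ⟨σ, ⟨hterms, forall₂_equated (fun _ => Query.mem_terms_of_mem_head)
    (fun _ => Query.mem_terms_of_mem_head) hhead, fun a ha => ?_⟩, ?_⟩
  · obtain ⟨b, hb, e⟩ := hbody a ha
    exact ⟨b, hb, (congrArg Prod.fst e).symm, forall₂_equated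
      (fun _ => Query.mem_terms_of_mem_args ha) (fun _ => Query.mem_terms_of_mem_args hb)
      (congrArg Prod.snd e)⟩
  · rintro n ⟨a, ha, hn⟩
    obtain ⟨b, hb, e⟩ := hbody a ha
    have hargs : b.args.map (Term.eval ι v) = a.args.map (Term.eval ι w) := congrArg Prod.snd e
    have hw : w n ∈ b.args.map (Term.eval ι v) :=
      hargs ▸ List.mem_map_of_mem (f := Term.eval ι w) hn
    obtain ⟨t, ht, htw⟩ := List.mem_map.1 hw
    exact hσw n t (List.mem_append_right _ (Query.mem_terms_of_mem_args hb ht)) htw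

/-- If `t < d` is true for a constant `d` of an open LSI of `Q₁`, then `t ≠ d` is derivable. -/
def StrictlyDerived (ι : ℚ ↪o D) (Q₁ Q₂ : Query) (v : ℕ → D) : Prop :=
  ∀ t ∈ Q₁.terms ++ Q₂.terms, ∀ d, Q₁.OpenLSIConst d → t.eval ι v < ι d →
    Derivable Q₁ Q₂ (.ne t (.const d))

variable {P : Term → ℚ → Prop} {σ : ℕ → Term}

theorem Derivable.of_mem_image (hcl : Q₁.IsSemiInterval)
    (hm : IsPinnedModel ι (Q₁.terms ++ Q₂.terms) (Theory Q₁ Q₂) P v)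
    (hopen : StrictlyDerived ι Q₁ Q₂ v) {e : AC} (he : e ∈ Q₁.acs) (hrsi : ¬ e.IsRSI)
    (hσ : σ e.lhs ∈ Q₁.terms ++ Q₂.terms) (hσe : e.Holds ι fun n => (σ n).eval ι v) :
    ∀ f ∈ e.image σ, Derivable Q₁ Q₂ f := by
  obtain ⟨d, hd⟩ := hcl.rhs_const e he
  have hdT : Term.const d ∈ Q₁.terms ++ Q₂.terms :=
    List.mem_append_left _ (hd ▸ Query.rhs_mem_terms he)
  rw [AC.Holds, hd] at hσe
  rw [AC.image, hd, Term.subst]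
  rcases hcl.op e he with hop | hop | hop
  · rw [hop] at hσe ⊢
    have hle : Derivable Q₁ Q₂ (.le (σ e.lhs) (.const d)) := hm.le_const _ hσ d hdT hσe
    simpa only [CompOp.formulas, List.forall_mem_singleton] using hle
  · have hlt : (σ e.lhs).eval ι v < ι d := by rwa [hop] at hσe
    have hlsi : Q₁.OpenLSIConst d := ⟨e.lhs, by rw [← hd, ← hop]; exact he⟩
    have hle : Derivable Q₁ Q₂ (.le (σ e.lhs) (.const d)) := hm.le_const _ hσ d hdT hlt.le
    rw [hop]
    simpa only [CompOp.formulas, List.forall_mem_cons, List.not_mem_nil, IsEmpty.forall_iff,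
      implies_true, and_true] using And.intro hle (hopen _ hσ d hlsi hlt)
  · exact absurd hop hrsi

theorem Derivable.bot_of_isMapping (hcl : Q₁.IsSemiInterval) (hP : IsPinning (Theory Q₁ Q₂) P)
    (hm : IsPinnedModel ι (Q₁.terms ++ Q₂.terms) (Theory Q₁ Q₂) P v)
    (hopen : StrictlyDerived ι Q₁ Q₂ v) (hσ : IsMapping Q₁ Q₂ (Theory Q₁ Q₂) σ)
    (hacs : ∀ e ∈ Q₁.acs, e.Holds ι fun n => (σ n).eval ι v) : Derivable Q₁ Q₂ .bot := by
  by_contra h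
  have lhs_mem (e : AC) (he : e ∈ Q₁.acs) : σ e.lhs ∈ Q₁.terms ++ Q₂.terms :=
    hσ.terms _ (Query.lhs_mem_terms he)
  have image_derivable (e : AC) (he : e ∈ Q₁.acs) (hrsi : ¬ e.IsRSI) :
      ∀ f ∈ e.image σ, Derivable Q₁ Q₂ f :=
    Derivable.of_mem_image hcl hm hopen he hrsi (lhs_mem e he) (hacs e he)
  by_cases hex : ∃ e ∈ Q₁.acs, e.IsRSI
  · obtain ⟨e, he, hrsi⟩ := hex
    have hneg : ∀ f ∈ e.op.neg.formulas (σ e.lhs) (e.rhs.subst σ), Derivable Q₁ Q₂ f := fun f hf =>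
      .of_step (.mapping_neg hσ he hrsi (fun e' he' hne => image_derivable e' he' fun hrsi' =>
        hne (hcl.rsi_unique e' he' e he hrsi' hrsi)) hf) fun t ht => by
        rcases CompOp.eq_or_eq_of_mem_formulas hf ht with rfl | rfl
        · exact lhs_mem e he
        · exact hσ.terms _ (Query.rhs_mem_terms he)
    have hop : e.op.neg ≠ .ne := by rcases hrsi with hop | hop <;> simp [hop, CompOp.neg]
    have hrel := hm.rel_of_formulas_subset (isOrderTheory_derivable h) hP hop hneg
    rw [CompOp.neg_rel_iff, Term.eval_subst] at hrel
    exact hrel (hacs e he)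
  · push Not at hex
    exact h (.of_step (.mapping_bot hσ fun e he => image_derivable e he (hex e he))
      (by simp [Formula.terms]))

theorem IsPinnedModel.equated_of_eval_eq {T : List Term}
    (hm : IsPinnedModel ι T S (fun _ _ => False) v) {s t : Term} (hs : s ∈ T) (ht : t ∈ T)
    (e : s.eval ι v = t.eval ι v) : Equated S s t := by
  refine ⟨(hm.pinned_of_eq s hs t ht e).resolve_right ?_,
    (hm.pinned_of_eq t ht s hs e.symm).resolve_right ?_⟩ <;> simp

theorem AC.holds_congr_of_rhs_const {e : AC} (hrhs : ∃ d, e.rhs = .const d)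
    (h : v e.lhs = w e.lhs) : e.Holds ι v ↔ e.Holds ι w := by
  obtain ⟨d, hd⟩ := hrhs
  rw [AC.Holds, AC.Holds, h, hd, Term.eval, Term.eval]

/-- The pinning of the terms `y` for which `y < d` is a candidate image of an open LSI of `Q₁`
that is not derivable. -/
def openPinning (Q₁ Q₂ : Query) (y : Term) (d : ℚ) : Prop :=
  Q₁.OpenLSIConst d ∧ Derivable Q₁ Q₂ (.le y (.const d)) ∧ ¬ Derivable Q₁ Q₂ (.ne y (.const d))

theorem isPinning_openPinning : IsPinning (Theory Q₁ Q₂) (openPinning Q₁ Q₂) :=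
  fun _ _ h => h.2

theorem Query.OpenLSIConst.mem_terms {Q : Query} {d : ℚ} (h : Q.OpenLSIConst d) :
    .const d ∈ Q.terms :=
  h.elim fun _ he => Q.rhs_mem_terms he

theorem strictlyDerived_of_openPinning (h : ¬ Derivable Q₁ Q₂ .bot)
    (hm : IsPinnedModel ι (Q₁.terms ++ Q₂.terms) (Theory Q₁ Q₂) (openPinning Q₁ Q₂) v) :
    StrictlyDerived ι Q₁ Q₂ v := by
  intro t ht d hd hlt
  by_contra hne
  have hle := hm.le_const t ht d (List.mem_append_left _ hd.mem_terms) hlt.le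
  exact hlt.not_ge (hm.const_le_eval (isOrderTheory_derivable h) isPinning_openPinning ht
    ⟨hd, hle, hne⟩)

variable [DenselyOrdered D] [NoMinOrder D] [NoMaxOrder D]

theorem openPinning_separates_ne (h : ¬ Derivable Q₁ Q₂ .bot) (hcl : Q₁.IsSemiInterval)
    (hside : SideCondition ι Q₁ Q₂) {X Y : ℕ} (hXY : ⟨X, .ne, .var Y⟩ ∈ Q₂.acs) {d : ℚ}
    {y z : Term} (hy : openPinning Q₁ Q₂ y d) (hz : openPinning Q₁ Q₂ z d)
    (hyX : Derivable Q₁ Q₂ (.le y (.var X))) (hXd : Derivable Q₁ Q₂ (.le (.var X) (.const d)))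
    (hzY : Derivable Q₁ Q₂ (.le z (.var Y))) : ¬ Derivable Q₁ Q₂ (.le (.var Y) (.const d)) := by
  intro hYd
  have hT := isOrderTheory_derivable h
  have hne : Derivable Q₁ Q₂ (.ne (.var X) (.var Y)) :=
    .of_mem_formulas hXY (List.mem_singleton_self _)
  have hd := Derivable.le_refl hXd.right_mem_terms
  have hX := Derivable.le_refl hXd.left_mem_terms
  have hY := Derivable.le_refl hYd.left_mem_terms
  have hXne : ¬ Derivable Q₁ Q₂ (.ne (.var X) (.const d)) := fun hX =>
    hy.2.2 (hX.ne_of_between hyX hXd hy.2.1 hd)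
  have hYne : ¬ Derivable Q₁ Q₂ (.ne (.var Y) (.const d)) := fun hY =>
    hz.2.2 (hY.ne_of_between hzY hYd hz.2.1 hd)
  have hdX : ¬ Derivable Q₁ Q₂ (.le (.const d) (.var X)) := fun hdX =>
    have hYX := hYd.le_trans hdX
    hYne ((hT.ne_symm hne hYX).ne_of_between hY hYd hYX hXd)
  have hdY : ¬ Derivable Q₁ Q₂ (.le (.const d) (.var Y)) := fun hdY =>
    have hXY := hXd.le_trans hdY
    hXne (hne.ne_of_between hX hXd hXY hYd)
  have hrsi := hside.ne_shared X Y hXY d hy.1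
  exact hside.ne_closed X Y hXY d (.inl hy.1)
    ⟨.inl (closedLSI_of_derivable h hcl hXd hXne hdX hrsi),
      .inl (closedLSI_of_derivable h hcl hYd hYne hdY hrsi)⟩

theorem strictlyDerived_of_normalization (h : ¬ Derivable Q₁ Q₂ .bot) (hcl : Q₁.IsSemiInterval)
    (hnorm : ∀ d, Q₁.OpenLSIConst d → ¬ Q₁.OpenRSIConst d ∧ ∀ X, ¬ ClosedLSI ι Q₂.acs X d)
    (hm : IsPinnedModel ι (Q₁.terms ++ Q₂.terms) (Theory Q₁ Q₂) P v) :
    StrictlyDerived ι Q₁ Q₂ v := by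
  intro t ht d hd hlt
  have hT := isOrderTheory_derivable h
  have hdT := List.mem_append_left Q₂.terms hd.mem_terms
  cases t with
  | const k => exact hT.const_ne k d ht hdT fun e => hlt.ne (congrArg ι e)
  | var X =>
    by_contra hne
    refine (hnorm d hd).2 X (closedLSI_of_derivable h hcl
      (hm.le_const _ ht d hdT hlt.le) hne (fun hge => ?_) (hnorm d hd).1)
    exact hlt.not_ge (hm.eval_le hT hge)

theorem derivable_bot_of_contained (hcl : Q₁.IsSemiInterval)
    (hsafe : ∀ e ∈ Q₁.acs, Q₁.OccursInBody e.lhs) (hside : SideCondition ι Q₁ Q₂)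
    (hcont : Q₂.Contained ι Q₁) : Derivable Q₁ Q₂ .bot := by
  by_contra h
  have hT := isOrderTheory_derivable h
  rw [contained_iff_forall_canonical] at hcont
  by_cases hfree : Q₁.EquationFree
  · obtain ⟨v, hm⟩ := hT.exists_isPinnedModel ι isPinning_openPinning
    have hv := forall_acs_holds_of_isPinnedModel h isPinning_openPinning hm
      fun X Y hXY d y z => openPinning_separates_ne h hcl hside hXY
    obtain ⟨w, hbody, hw, hhead⟩ := hcont v hv
    obtain ⟨σ, hσ, hσw⟩ := exists_isMapping_of_equationFree hfree
      (fun t ht => hT.le_refl t (List.mem_append_right _ ht)) hbody hhead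
    exact h (.bot_of_isMapping hcl isPinning_openPinning hm (strictlyDerived_of_openPinning h hm)
      hσ fun e he => (AC.holds_congr_of_rhs_const (hcl.rhs_const e he)
        (hσw _ (hsafe e he))).2 (hw e he))
  · have hP : IsPinning (Theory Q₁ Q₂) fun _ _ => False := fun _ _ => False.elim
    obtain ⟨v, hm⟩ := hT.exists_isPinnedModel ι hP
    have hv := forall_acs_holds_of_isPinnedModel h hP hm fun _ _ _ _ _ _ => False.elim
    obtain ⟨w, hbody, hw, hhead⟩ := hcont v hv
    obtain ⟨σ, hσ, hσw⟩ := exists_isMapping_of_equated (S := Theory Q₁ Q₂)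
      (fun _ hs _ ht => hm.equated_of_eval_eq hs ht) hbody hhead
    exact h (.bot_of_isMapping hcl hP hm
      (strictlyDerived_of_normalization h hcl (hside.normalization hfree) hm)
      hσ fun e he => (AC.holds_congr_of_rhs_const (hcl.rhs_const e he)
        (hσw _ (hsafe e he))).2 (hw e he))

end Completeness

/-! ### Checking derivations in polynomial time -/

open Machine Machine.Data

section Encoding

theorem elems_encList {α : Type} (f : α → Data) (l : List α) :
    (encList f l).elems = l.map f := by
  induction l with
  | nil => rfl
  | cons a l ih => rw [encList, elems_pair, ih, List.map_cons]

theorem exists_mem_elems_encList {α : Type} {f : α → Data} {l : List α} {P : Data → Prop} :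
    (∃ e ∈ (encList f l).elems, P e) ↔ ∃ a ∈ l, P (f a) := by
  simp only [elems_encList, List.mem_map, exists_exists_and_eq_and]

theorem forall_mem_elems_encList {α : Type} {f : α → Data} {l : List α} {P : Data → Prop} :
    (∀ e ∈ (encList f l).elems, P e) ↔ ∀ a ∈ l, P (f a) := by
  simp only [elems_encList, List.forall_mem_map]

theorem size_encList {α : Type} (f : α → Data) (l : List α) :
    (encList f l).size = 1 + (l.map fun a => 1 + (f a).size).sum := by
  induction l with
  | nil => rfl
  | cons a l ih => rw [encList, size, ih, List.map_cons, List.sum_cons]; omega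

theorem Term.enc_injective : Function.Injective Term.enc := by
  rintro (m | c) (n | d) h
  all_goals simp only [Term.enc, Data.pair.injEq, Data.int.injEq, Nat.cast_inj,
    zero_ne_one, one_ne_zero, false_and, true_and] at h
  · rw [h]
  · rw [Rat.ext h.1 h.2]

theorem CompOp.enc_injective : Function.Injective CompOp.enc := by
  rintro (_ | _) (_ | _) <;> simp [CompOp.enc]

theorem AC.enc_injective : Function.Injective AC.enc := by
  rintro ⟨m, op, s⟩ ⟨n, op', t⟩ h
  simp only [AC.enc, Data.pair.injEq, Data.int.injEq, Nat.cast_inj] at h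
  rw [CompOp.enc_injective h.1, h.2.1, Term.enc_injective h.2.2]

/-- The code of the formula `a ≤ b`, given codes of `a` and `b`. -/
def leCode (a b : Data) : Data := .pair (.int 0) (.pair a b)

/-- The code of the formula `a ≠ b`, given codes of `a` and `b`. -/
def neCode (a b : Data) : Data := .pair (.int 1) (.pair a b)

/-- Encoding of formulas as machine data. -/
def Formula.enc : Formula → Data
  | .bot => .int 0
  | .le a b => leCode a.enc b.enc
  | .ne a b => neCode a.enc b.enc

theorem Formula.enc_injective : Function.Injective Formula.enc := by
  rintro (_ | _ | _) (_ | _ | _) h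
  all_goals simp_all [Formula.enc, leCode, neCode, Term.enc_injective.eq_iff]

/-- The encoded list of the codes of `op.formulas a b`. -/
def formulaCodes (op a b : Data) : Data :=
  if op = CompOp.enc .lt then .pair (leCode a b) (.pair (neCode a b) (.int 0))
  else if op = CompOp.enc .le then .pair (leCode a b) (.int 0)
  else if op = CompOp.enc .gt then .pair (leCode b a) (.pair (neCode b a) (.int 0))
  else if op = CompOp.enc .ge then .pair (leCode b a) (.int 0)
  else if op = CompOp.enc .eq then .pair (leCode a b) (.pair (leCode b a) (.int 0))
  else .pair (neCode a b) (.int 0)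

theorem formulaCodes_enc (op : CompOp) (a b : Term) :
    formulaCodes op.enc a.enc b.enc = encList Formula.enc (op.formulas a b) := by
  cases op <;> simp [formulaCodes, CompOp.formulas, CompOp.enc, encList, Formula.enc]

/-- Some occurrence of a term in the query with code `q` has a code that satisfies `P`. -/
def ExistsTermCode (q : Data) (P : Data → Prop) : Prop :=
  (∃ t ∈ q.left.elems, P t) ∨ (∃ a ∈ q.right.left.elems, ∃ t ∈ a.right.elems, P t) ∨
    ∃ c ∈ q.right.right.elems, P (.pair (.int 0) c.right.left) ∨ P c.right.right

theorem exists_mem_flatMap {α β : Type*} {l : List α} {f : α → List β} {p : β → Prop} :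
    (∃ b ∈ l.flatMap f, p b) ↔ ∃ a ∈ l, ∃ b ∈ f a, p b := by
  grind

theorem existsTermCode_enc_iff {Q : Query} {P : Data → Prop} :
    ExistsTermCode Q.enc P ↔ ∃ s ∈ Q.terms, P s.enc := by
  simp only [ExistsTermCode, Query.enc, left_pair, right_pair, exists_mem_elems_encList, Atom.enc,
    AC.enc, Query.terms, List.mem_append, or_and_right, exists_or, or_assoc, exists_mem_flatMap,
    List.exists_mem_cons_iff, List.not_mem_nil, false_and, exists_false, or_false, Term.enc]

/-- `t` is the code of a term that occurs in one of the two queries of the instance `x`. -/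
def IsTermCode (x t : Data) : Prop :=
  ExistsTermCode x.left (· = t) ∨ ExistsTermCode x.right (· = t)

/-- `f` is the code of a formula whose terms occur in the queries of the instance `x`. -/
def IsFormulaCode (x f : Data) : Prop :=
  f = .int 0 ∨ (f = leCode f.right.left f.right.right ∨ f = neCode f.right.left f.right.right) ∧
    IsTermCode x f.right.left ∧ IsTermCode x f.right.right

variable {Q₁ Q₂ : Query}

theorem isTermCode_iff {t : Data} :
    IsTermCode (.pair Q₁.enc Q₂.enc) t ↔ ∃ s ∈ Q₁.terms ++ Q₂.terms, s.enc = t := by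
  simp only [IsTermCode, left_pair, right_pair, existsTermCode_enc_iff, List.mem_append,
    or_and_right, exists_or]

theorem isFormulaCode_iff {f : Data} :
    IsFormulaCode (.pair Q₁.enc Q₂.enc) f ↔
      ∃ φ : Formula, φ.enc = f ∧ ∀ t ∈ φ.terms, t ∈ Q₁.terms ++ Q₂.terms := by
  constructor
  · rintro (rfl | ⟨hf, ha, hb⟩)
    · exact ⟨.bot, rfl, List.forall_mem_nil _⟩
    · obtain ⟨a, haT, ha'⟩ := isTermCode_iff.1 ha
      obtain ⟨b, hbT, hb'⟩ := isTermCode_iff.1 hb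
      rw [← ha', ← hb'] at hf
      rcases hf with rfl | rfl
      · exact ⟨.le a b, rfl, List.forall_mem_cons.2 ⟨haT, List.forall_mem_singleton.2 hbT⟩⟩
      · exact ⟨.ne a b, rfl, List.forall_mem_cons.2 ⟨haT, List.forall_mem_singleton.2 hbT⟩⟩
  · rintro ⟨_ | ⟨a, b⟩ | ⟨a, b⟩, rfl, h⟩
    · exact .inl rfl
    · exact .inr ⟨.inl rfl, isTermCode_iff.2 ⟨a, h a (by simp [Formula.terms]), rfl⟩,
        isTermCode_iff.2 ⟨b, h b (by simp [Formula.terms]), rfl⟩⟩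
    · exact .inr ⟨.inr rfl, isTermCode_iff.2 ⟨a, h a (by simp [Formula.terms]), rfl⟩,
        isTermCode_iff.2 ⟨b, h b (by simp [Formula.terms]), rfl⟩⟩

end Encoding

section Checker

/-- The entries of `H` list the term codes of `x` that are assigned to the term codes of its first
query by a substitution. -/
structure IsSubstCode (x H : Data) : Prop where
  total : ¬ ExistsTermCode x.left fun s => ¬ Known H s
  functional : ∀ e ∈ H.elems, ∀ e' ∈ H.elems, e.left = e'.left → e.right = e'.right
  terms : ∀ e ∈ H.elems, IsTermCode x e.right
  consts : ∀ e ∈ H.elems, e.left.left ≠ .int 0 → e.right = e.left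

/-- The value assigned by `H` to the term code `s` satisfies `P`. -/
def AssignedCode (H s : Data) (P : Data → Prop) : Prop :=
  ∃ e ∈ H.elems, e.left = s ∧ P e.right

/-- `H` maps the list of term codes `l` to the list `m`, up to the equalities in `L`. -/
def MatchCode (H L l m : Data) : Prop :=
  Scan (fun s m => m.IsPair ∧ AssignedCode H s fun t =>
    Known L (leCode t m.left) ∧ Known L (leCode m.left t)) (fun m => ¬ m.IsPair) l m

/-- The counterpart of `IsMapping`. -/
def IsMappingCode (x H L : Data) : Prop :=
  IsSubstCode x H ∧ MatchCode H L x.left.left x.right.left ∧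
    ∀ a ∈ x.left.right.left.elems, ∃ b ∈ x.right.right.left.elems,
      a.left = b.left ∧ MatchCode H L a.right b.right

/-- The values assigned by `H` to the two sides of the comparison with code `c` satisfy `P`. -/
def AssignedSides (H c : Data) (P : Data → Data → Prop) : Prop :=
  AssignedCode H (.pair (.int 0) c.right.left) fun a => AssignedCode H c.right.right (P a)

/-- The image under `H` of the comparison with code `c` belongs to `L`. -/
def ImageKnown (H L c : Data) : Prop :=
  AssignedSides H c fun a b => ∀ g ∈ (formulaCodes c.left a b).elems, Known L g

/-- `f` codes a conjunct of the negated image under `H` of the right semi-interval comparison with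
code `c`. -/
def IsNegImage (H f c : Data) : Prop :=
  AssignedSides H c fun a b =>
    c.left = CompOp.enc .ge ∧ f ∈ (formulaCodes (CompOp.enc .lt) a b).elems ∨
    c.left = CompOp.enc .gt ∧ f ∈ (formulaCodes (CompOp.enc .le) a b).elems

/-- The counterpart of the rules of `Step` about mappings. -/
def IsMappingStep (x f H L : Data) : Prop :=
  IsMappingCode x H L ∧
    (f = .int 0 ∧ (∀ c ∈ x.left.right.right.elems, ImageKnown H L c) ∨
    ∃ c ∈ x.left.right.right.elems, IsNegImage H f c ∧
      ∀ c' ∈ x.left.right.right.elems, c' ≠ c → ImageKnown H L c')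

/-- The counterpart of the rules of `Step` about constants.  The inequality between two fractions
is checked by cross-multiplication. -/
def IsConstStep (f : Data) : Prop :=
  f.right.left.left = .int 1 ∧ f.right.right.left = .int 1 ∧
    (f.left = .int 0 ∧ (f.right.left.right.left.imul f.right.right.right.right).ile
      (f.right.right.right.left.imul f.right.left.right.right) ∨
    f.left = .int 1 ∧ f.right.left ≠ f.right.right)

/-- The counterpart of the rules of `Step` about an arbitrary linear order.  The hint `H` contains
the terms that occur in the premises only. -/
def IsOrderStep (f H L : Data) : Prop :=
  f = leCode f.right.left f.right.right ∧ (f.right.left = f.right.right ∨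
    Known L (leCode f.right.left H) ∧ Known L (leCode H f.right.right)) ∨
  f = neCode f.right.left f.right.right ∧ Known L (neCode H.left H.right) ∧
    (Known L (leCode f.right.left H.left) ∧ Known L (leCode H.left f.right.right)) ∧
    Known L (leCode f.right.left H.right) ∧ Known L (leCode H.right f.right.right)

/-- The counterpart of `Step`, for the instance `x`. -/
def IsStep (x f H L : Data) : Prop :=
  (∃ c ∈ x.right.right.right.elems,
    f ∈ (formulaCodes c.left (.pair (.int 0) c.right.left) c.right.right).elems) ∨
  IsConstStep f ∨ IsOrderStep f H L ∨ (f = .int 0 ∧ Known L (neCode H H)) ∨ IsMappingStep x f H L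

end Checker

section CheckerTime

variable {f g h k : Data → Data} {P : Data → Data → Prop}

@[fun_prop]
theorem polyTime_leCode (hf : PolyTime f) (hg : PolyTime g) :
    PolyTime fun z => leCode (f z) (g z) := by
  unfold leCode; fun_prop

@[fun_prop]
theorem polyTime_neCode (hf : PolyTime f) (hg : PolyTime g) :
    PolyTime fun z => neCode (f z) (g z) := by
  unfold neCode; fun_prop

@[fun_prop]
theorem polyTime_formulaCodes (hf : PolyTime f) (hg : PolyTime g) (hh : PolyTime h) :
    PolyTime fun z => formulaCodes (f z) (g z) (h z) := by
  unfold formulaCodes; fun_prop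

@[fun_prop]
theorem polyTimePred_mem_elems (hf : PolyTime f) (hg : PolyTime g) :
    PolyTimePred fun z => f z ∈ (g z).elems := by
  simpa only [exists_eq_right] using PolyTimePred.exists_elems
    (P := fun z e => e = f z) hg (by fun_prop)

theorem polyTimePred_existsTermCode (hg : PolyTime g)
    (hP : PolyTimePred fun w => P w.left w.right) :
    PolyTimePred fun z => ExistsTermCode (g z) (P z) := by
  have comp_left {k : Data → Data} (hk : PolyTime k) : PolyTimePred fun w => P w.left (k w) :=
    hP.comp (f := fun w => .pair w.left (k w)) (by fun_prop)
  have comp_left_left := hP.comp (f := fun w => .pair w.left.left w.right) (by fun_prop)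
  exact (PolyTimePred.exists_elems hg.left hP).or
    ((PolyTimePred.exists_elems hg.right.left
      (PolyTimePred.exists_elems (P := fun w => P w.left) (by fun_prop) comp_left_left)).or
    (PolyTimePred.exists_elems hg.right.right
      ((comp_left (by fun_prop)).or (comp_left (by fun_prop)))))

@[fun_prop]
theorem polyTimePred_isTermCode (hf : PolyTime f) (hg : PolyTime g) :
    PolyTimePred fun z => IsTermCode (f z) (g z) :=
  (polyTimePred_existsTermCode (P := fun z t => t = g z) hf.left (by fun_prop)).or
    (polyTimePred_existsTermCode (P := fun z t => t = g z) hf.right (by fun_prop))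

@[fun_prop]
theorem polyTimePred_isFormulaCode (hf : PolyTime f) (hg : PolyTime g) :
    PolyTimePred fun z => IsFormulaCode (f z) (g z) := by
  unfold IsFormulaCode; fun_prop

@[fun_prop]
theorem polyTimePred_isSubstCode (hf : PolyTime f) (hg : PolyTime g) :
    PolyTimePred fun z => IsSubstCode (f z) (g z) := by
  have total := (polyTimePred_existsTermCode (P := fun z s => ¬ Known (g z) s) hf.left
    (by fun_prop)).not
  have functional : PolyTimePred fun z =>
      ∀ e ∈ (g z).elems, ∀ e' ∈ (g z).elems, e.left = e'.left → e.right = e'.right :=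
    .forall_elems hg <| .forall_elems (g := fun w => g w.left)
      (P := fun w e' => w.right.left = e'.left → w.right.right = e'.right)
      (by fun_prop) (by fun_prop)
  have terms := PolyTimePred.forall_elems (P := fun z e => IsTermCode (f z) e.right) hg
    (by fun_prop)
  have consts := PolyTimePred.forall_elems
    (P := fun _ e => e.left.left ≠ .int 0 → e.right = e.left) hg (by fun_prop)
  convert total.and (functional.and (terms.and consts)) using 2 with z
  exact ⟨fun h => ⟨h.1, h.2, h.3, h.4⟩, fun ⟨h₁, h₂, h₃, h₄⟩ => ⟨h₁, h₂, h₃, h₄⟩⟩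

theorem polyTimePred_assignedCode (hf : PolyTime f) (hg : PolyTime g)
    (hP : PolyTimePred fun w => P w.left w.right) :
    PolyTimePred fun z => AssignedCode (f z) (g z) (P z) :=
  .exists_elems hf <| .and (by fun_prop)
    (hP.comp (f := fun w => .pair w.left w.right.right) (by fun_prop))

@[fun_prop]
theorem polyTimePred_matchCode (hf : PolyTime f) (hg : PolyTime g) (hh : PolyTime h)
    (hk : PolyTime k) : PolyTimePred fun z => MatchCode (f z) (g z) (h z) (k z) := by
  have hR := polyTimePred_assignedCode (f := fun w => f w.left) (g := fun w => w.right.left)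
    (P := fun w t => Known (g w.left) (leCode t w.right.right.left) ∧
      Known (g w.left) (leCode w.right.right.left t)) (by fun_prop) (by fun_prop) (by fun_prop)
  exact .scan (R := fun z s m => m.IsPair ∧ AssignedCode (f z) s fun t =>
    Known (g z) (leCode t m.left) ∧ Known (g z) (leCode m.left t))
    (.and (by fun_prop) hR) (by fun_prop) hh hk

@[fun_prop]
theorem polyTimePred_isMappingCode (hf : PolyTime f) (hg : PolyTime g) (hh : PolyTime h) :
    PolyTimePred fun z => IsMappingCode (f z) (g z) (h z) := by
  have body := PolyTimePred.forall_elems (g := fun z => (f z).left.right.left)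
    (P := fun z a => ∃ b ∈ (f z).right.right.left.elems,
      a.left = b.left ∧ MatchCode (g z) (h z) a.right b.right) (by fun_prop) <|
    .exists_elems (g := fun w => (f w.left).right.right.left)
      (P := fun w b => w.right.left = b.left ∧
        MatchCode (g w.left) (h w.left) w.right.right b.right) (by fun_prop) (by fun_prop)
  exact .and (by fun_prop) (.and (by fun_prop) body)

theorem polyTimePred_assignedSides {P : Data → Data → Data → Prop} (hf : PolyTime f)
    (hg : PolyTime g) (hP : PolyTimePred fun w => P w.left w.right.left w.right.right) :
    PolyTimePred fun z => AssignedSides (f z) (g z) (P z) :=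
  polyTimePred_assignedCode hf (by fun_prop) <|
    polyTimePred_assignedCode (P := fun w => P w.left w.right) (by fun_prop) (by fun_prop) <|
      hP.comp (f := fun w => .pair w.left.left (.pair w.left.right w.right)) (by fun_prop)

@[fun_prop]
theorem polyTimePred_imageKnown (hf : PolyTime f) (hg : PolyTime g) (hh : PolyTime h) :
    PolyTimePred fun z => ImageKnown (f z) (g z) (h z) :=
  polyTimePred_assignedSides
    (P := fun z a b => ∀ e ∈ (formulaCodes (h z).left a b).elems, Known (g z) e) hf hh <|
    .forall_elems (g := fun w => formulaCodes (h w.left).left w.right.left w.right.right)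
      (P := fun w e => Known (g w.left) e) (by fun_prop) (by fun_prop)

@[fun_prop]
theorem polyTimePred_isNegImage (hf : PolyTime f) (hg : PolyTime g) (hh : PolyTime h) :
    PolyTimePred fun z => IsNegImage (f z) (g z) (h z) :=
  polyTimePred_assignedSides (P := fun z a b =>
    (h z).left = CompOp.enc .ge ∧ g z ∈ (formulaCodes (CompOp.enc .lt) a b).elems ∨
    (h z).left = CompOp.enc .gt ∧ g z ∈ (formulaCodes (CompOp.enc .le) a b).elems) hf hh
    (by fun_prop)

@[fun_prop]
theorem polyTimePred_isMappingStep (hf : PolyTime f) (hg : PolyTime g) (hh : PolyTime h)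
    (hk : PolyTime k) : PolyTimePred fun z => IsMappingStep (f z) (g z) (h z) (k z) := by
  have bot := PolyTimePred.forall_elems (g := fun z => (f z).left.right.right)
    (P := fun z c => ImageKnown (h z) (k z) c) (by fun_prop) (by fun_prop)
  have others := PolyTimePred.forall_elems (g := fun w => (f w.left).left.right.right)
    (P := fun w c' => c' ≠ w.right → ImageKnown (h w.left) (k w.left) c') (by fun_prop)
    (by fun_prop)
  have neg := PolyTimePred.exists_elems (g := fun z => (f z).left.right.right)
    (P := fun z c => IsNegImage (h z) (g z) c ∧
      ∀ c' ∈ (f z).left.right.right.elems, c' ≠ c → ImageKnown (h z) (k z) c')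
    (by fun_prop) (.and (by fun_prop) others)
  exact .and (by fun_prop) (.or (.and (by fun_prop) bot) neg)

@[fun_prop]
theorem polyTimePred_isStep (hf : PolyTime f) (hg : PolyTime g) (hh : PolyTime h)
    (hk : PolyTime k) : PolyTimePred fun z => IsStep (f z) (g z) (h z) (k z) := by
  have comparison := PolyTimePred.exists_elems (g := fun z => (f z).right.right.right)
    (P := fun z c => g z ∈
      (formulaCodes c.left (.pair (.int 0) c.right.left) c.right.right).elems)
    (by fun_prop) (by fun_prop)
  refine comparison.or ?_
  unfold IsConstStep IsOrderStep
  fun_prop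

end CheckerTime

section CheckerCorrectness

variable {Q₁ Q₂ : Query} {H L : Data} {σ : ℕ → Term} {T : List Term} {f : Formula}

/-- The formulas whose codes are conclusions in the list `L`. -/
def knownFormulas (L : Data) : Set Formula := {f | Known L f.enc}

/-- On the terms in `T`, the datum `H` codes the substitution `σ`. -/
def Encodes (H : Data) (σ : ℕ → Term) (T : List Term) : Prop :=
  ∀ s ∈ T, ∀ P : Data → Prop, AssignedCode H s.enc P ↔ P (s.subst σ).enc

theorem IsSubstCode.exists_encodes (h : IsSubstCode (.pair Q₁.enc Q₂.enc) H) :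
    ∃ σ, (∀ s ∈ Q₁.terms, s.subst σ ∈ Q₁.terms ++ Q₂.terms) ∧ Encodes H σ Q₁.terms := by
  have assigned : ∀ s ∈ Q₁.terms, ∃ t ∈ Q₁.terms ++ Q₂.terms,
      ∃ e ∈ H.elems, e.left = s.enc ∧ e.right = t.enc := by
    intro s hs
    have htotal := h.total
    simp only [left_pair, existsTermCode_enc_iff, not_exists, not_and, not_not] at htotal
    obtain ⟨e, he, hes⟩ := htotal s hs
    obtain ⟨t, ht, het⟩ := isTermCode_iff.1 (h.terms e he)
    exact ⟨t, ht, e, he, hes, het.symm⟩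
  have : Nonempty Data := ⟨H⟩
  choose! τ hτ e he hleft hright using assigned
  have subst_eq : ∀ s ∈ Q₁.terms, s.subst (fun n => τ (.var n)) = τ s := by
    rintro (n | c) hs
    · rfl
    · have hc := h.consts _ (he _ hs) (by simp [hleft _ hs, Term.enc])
      rw [hleft _ hs, hright _ hs] at hc
      exact (Term.enc_injective hc).symm
  refine ⟨fun n => τ (.var n), fun s hs => subst_eq s hs ▸ hτ s hs, fun s hs P => ?_⟩
  rw [subst_eq s hs, ← hright s hs]
  constructor
  · rintro ⟨e', he', hleft', hP⟩
    exact h.functional _ he' _ (he s hs) (hleft'.trans (hleft s hs).symm) ▸ hP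
  · exact fun hP => ⟨e s, he s hs, hleft s hs, hP⟩

theorem exists_isSubstCode (hσ : ∀ s ∈ Q₁.terms, s.subst σ ∈ Q₁.terms ++ Q₂.terms) :
    IsSubstCode (.pair Q₁.enc Q₂.enc)
        (encList (fun s : Term => .pair s.enc (s.subst σ).enc) Q₁.terms) ∧
      Encodes (encList (fun s : Term => .pair s.enc (s.subst σ).enc) Q₁.terms) σ Q₁.terms := by
  refine ⟨⟨?_, ?_, ?_, ?_⟩, fun s hs P => ?_⟩
  · simp only [left_pair, existsTermCode_enc_iff, not_exists, not_and, not_not]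
    exact fun s hs => exists_mem_elems_encList.2 ⟨s, hs, rfl⟩
  · simp only [forall_mem_elems_encList, left_pair, right_pair]
    exact fun s _ s' _ e => Term.enc_injective e ▸ rfl
  · simp only [forall_mem_elems_encList, right_pair]
    exact fun s hs => isTermCode_iff.2 ⟨_, hσ s hs, rfl⟩
  · simp only [forall_mem_elems_encList, left_pair, right_pair]
    rintro (n | c) - h
    · exact (h rfl).elim
    · rfl
  · simp only [AssignedCode, exists_mem_elems_encList, left_pair, right_pair,
      Term.enc_injective.eq_iff]
    exact ⟨fun ⟨_, _, e, h⟩ => e ▸ h, fun h => ⟨s, hs, rfl, h⟩⟩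

theorem Encodes.matchCode_iff (hH : Encodes H σ T) {l m : List Term} (hl : ∀ s ∈ l, s ∈ T) :
    MatchCode H L (encList Term.enc l) (encList Term.enc m) ↔
      List.Forall₂ (fun s t => Equated (knownFormulas L) (s.subst σ) t) l m := by
  induction l generalizing m with
  | nil => cases m <;> simp [MatchCode, encList, Scan]
  | cons s l ih =>
    rw [List.forall_mem_cons] at hl
    cases m with
    | nil => simp [MatchCode, encList, Scan]
    | cons t m =>
      rw [List.forall₂_cons, ← ih hl.2]
      simp only [MatchCode, encList, Scan, isPair_pair, true_and, left_pair, right_pair]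
      rw [hH s hl.1]
      rfl

theorem Encodes.isMappingCode_iff (hH : Encodes H σ Q₁.terms)
    (hsubst : IsSubstCode (.pair Q₁.enc Q₂.enc) H)
    (hσ : ∀ s ∈ Q₁.terms, s.subst σ ∈ Q₁.terms ++ Q₂.terms) :
    IsMappingCode (.pair Q₁.enc Q₂.enc) H L ↔ IsMapping Q₁ Q₂ (knownFormulas L) σ := by
  have body_iff {a b : Atom} (ha : a ∈ Q₁.body) :
      Data.int a.rel = .int b.rel ∧
        MatchCode H L (encList Term.enc a.args) (encList Term.enc b.args) ↔ a.rel = b.rel ∧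
      List.Forall₂ (fun s t => Equated (knownFormulas L) (s.subst σ) t) a.args b.args := by
    rw [hH.matchCode_iff fun s hs => Query.mem_terms_of_mem_args ha hs, Data.int.injEq,
      Nat.cast_inj]
  rw [IsMappingCode, and_iff_right hsubst]
  simp only [Query.enc, Atom.enc, left_pair, right_pair,
    forall_mem_elems_encList, exists_mem_elems_encList,
    hH.matchCode_iff fun _ => Query.mem_terms_of_mem_head]
  constructor
  · rintro ⟨head, body⟩
    refine ⟨hσ, head, fun a ha => ?_⟩
    obtain ⟨b, hb, h⟩ := body a ha
    exact ⟨b, hb, (body_iff ha).1 h⟩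
  · rintro ⟨-, head, body⟩
    refine ⟨head, fun a ha => ?_⟩
    obtain ⟨b, hb, h⟩ := body a ha
    exact ⟨b, hb, (body_iff ha).2 h⟩

theorem Encodes.assignedSides_iff (hH : Encodes H σ Q₁.terms) {c : AC} (hc : c ∈ Q₁.acs)
    {P : Data → Data → Prop} :
    AssignedSides H c.enc P ↔ P (σ c.lhs).enc (c.rhs.subst σ).enc := by
  have lhs_iff := hH _ (Query.lhs_mem_terms hc)
  have rhs_iff := hH _ (Query.rhs_mem_terms hc)
  exact (lhs_iff _).trans (rhs_iff _)

theorem Encodes.imageKnown_iff (hH : Encodes H σ Q₁.terms) {c : AC} (hc : c ∈ Q₁.acs) :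
    ImageKnown H L c.enc ↔ ∀ g ∈ c.image σ, g ∈ knownFormulas L := by
  rw [ImageKnown, hH.assignedSides_iff hc, AC.enc, left_pair, formulaCodes_enc,
    forall_mem_elems_encList]
  rfl

theorem enc_mem_elems_formulaCodes_iff {op : CompOp} {a b : Term} :
    f.enc ∈ (formulaCodes op.enc a.enc b.enc).elems ↔ f ∈ op.formulas a b := by
  rw [formulaCodes_enc, elems_encList, List.mem_map_of_injective Formula.enc_injective]

theorem Encodes.isNegImage_iff (hH : Encodes H σ Q₁.terms) {c : AC} (hc : c ∈ Q₁.acs) :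
    IsNegImage H f.enc c.enc ↔
      c.IsRSI ∧ f ∈ c.op.neg.formulas (σ c.lhs) (c.rhs.subst σ) := by
  rw [IsNegImage, hH.assignedSides_iff hc]
  simp only [enc_mem_elems_formulaCodes_iff, AC.enc, left_pair, CompOp.enc_injective.eq_iff,
    AC.IsRSI, or_and_right]
  refine or_congr (and_congr_right fun h => ?_) (and_congr_right fun h => ?_) <;> rw [h] <;> rfl

theorem IsConstStep.step {S : Set Formula} (h : IsConstStep f.enc) : Step Q₁ Q₂ S f := by
  rcases f with _ | ⟨_ | c, _ | d⟩ | ⟨_ | c, _ | d⟩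
  all_goals simp only [IsConstStep, Formula.enc, leCode, neCode, Term.enc, left_pair, right_pair,
    left_int, right_int, Data.int.injEq, Data.pair.injEq, zero_ne_one, one_ne_zero, false_and,
    and_false, true_and, or_false, false_or, imul_int, ile_int, ne_eq, not_and] at h
  · exact .const_le ((Rat.le_iff c d).2 h)
  · exact .const_ne fun e => h (congrArg Rat.num e) (mod_cast congrArg Rat.den e)

theorem exists_enc_eq_of_enc_eq_leCode {a b : Data} (h : f.enc = leCode a b) :
    ∃ s t : Term, s.enc = a ∧ t.enc = b := by
  rcases f with _ | ⟨s, t⟩ | ⟨s, t⟩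
  all_goals simp only [Formula.enc, leCode, neCode, Data.pair.injEq, Data.int.injEq, reduceCtorEq,
    one_ne_zero, true_and, false_and] at h
  exact ⟨s, t, h⟩

theorem exists_enc_eq_of_enc_eq_neCode {a b : Data} (h : f.enc = neCode a b) :
    ∃ s t : Term, s.enc = a ∧ t.enc = b := by
  rcases f with _ | ⟨s, t⟩ | ⟨s, t⟩
  all_goals simp only [Formula.enc, leCode, neCode, Data.pair.injEq, Data.int.injEq, reduceCtorEq,
    zero_ne_one, true_and, false_and] at h
  exact ⟨s, t, h⟩

theorem IsOrderStep.step (hL : ∀ g, Known L g → ∃ φ : Formula, φ.enc = g)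
    (h : IsOrderStep f.enc H L) : Step Q₁ Q₂ (knownFormulas L) f := by
  rcases f with _ | ⟨a, b⟩ | ⟨a, b⟩
  · simp [IsOrderStep, Formula.enc, leCode, neCode] at h
  · rcases h with ⟨-, hab | ⟨haH, hHb⟩⟩ | ⟨h, -⟩
    · rw [Term.enc_injective hab]
      exact .refl b
    · obtain ⟨φ, hφ⟩ := hL _ haH
      obtain ⟨-, u, -, rfl⟩ := exists_enc_eq_of_enc_eq_leCode hφ
      exact .trans haH hHb
    · simp [Formula.enc, leCode, neCode] at h
  · rcases h with ⟨h, -⟩ | ⟨-, hne, ⟨hau, hub⟩, haw, hwb⟩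
    · simp [Formula.enc, leCode, neCode] at h
    · obtain ⟨φ, hφ⟩ := hL _ hne
      obtain ⟨u, w, hu, hw⟩ := exists_enc_eq_of_enc_eq_neCode hφ
      rw [← hu] at hne hau hub
      rw [← hw] at hne haw hwb
      exact .ne_between hne hau hub haw hwb

theorem IsMappingStep.step (h : IsMappingStep (.pair Q₁.enc Q₂.enc) f.enc H L) :
    Step Q₁ Q₂ (knownFormulas L) f := by
  obtain ⟨hmap, h⟩ := h
  obtain ⟨σ, hσ, hH⟩ := hmap.1.exists_encodes
  rw [hH.isMappingCode_iff hmap.1 hσ] at hmap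
  simp only [left_pair, right_pair, Query.enc, forall_mem_elems_encList,
    exists_mem_elems_encList] at h
  rcases h with ⟨hbot, himage⟩ | ⟨c, hc, hneg, himage⟩
  · rw [show f = .bot from Formula.enc_injective hbot]
    exact .mapping_bot hmap fun c hc => (hH.imageKnown_iff hc).1 (himage c hc)
  · rw [hH.isNegImage_iff hc] at hneg
    exact .mapping_neg hmap hc hneg.1 (fun c' hc' hne => (hH.imageKnown_iff hc').1
      (himage c' hc' (AC.enc_injective.ne hne))) hneg.2

theorem exists_comparison_iff :
    (∃ c ∈ Q₂.enc.right.right.elems,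
      f.enc ∈ (formulaCodes c.left (.pair (.int 0) c.right.left) c.right.right).elems) ↔
      ∃ c ∈ Q₂.acs, f ∈ c.op.formulas (.var c.lhs) c.rhs := by
  simp only [Query.enc, right_pair, exists_mem_elems_encList]
  exact exists_congr fun c => and_congr_right fun _ =>
    enc_mem_elems_formulaCodes_iff (a := .var c.lhs)

theorem IsStep.step (hL : ∀ g, Known L g → ∃ φ : Formula, φ.enc = g)
    (h : IsStep (.pair Q₁.enc Q₂.enc) f.enc H L) : Step Q₁ Q₂ (knownFormulas L) f := by
  rcases h with hcmp | hconst | horder | ⟨hbot, hne⟩ | hmap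
  · obtain ⟨c, hc, hf⟩ := exists_comparison_iff.1 hcmp
    exact .comparison hc hf
  · exact hconst.step
  · exact horder.step hL
  · rw [show f = .bot from Formula.enc_injective hbot]
    obtain ⟨φ, hφ⟩ := hL _ hne
    obtain ⟨a, -, rfl, -⟩ := exists_enc_eq_of_enc_eq_neCode hφ
    exact .contradiction hne
  · exact hmap.step

theorem size_encList_le {α : Type} {e : α → Data} {l : List α} {k : ℕ}
    (h : ∀ a ∈ l, (e a).size ≤ k) : (encList e l).size ≤ 1 + l.length * (k + 1) := by
  rw [size_encList]
  gcongr
  rw [← List.length_map, ← smul_eq_mul]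
  refine List.sum_le_card_nsmul _ _ ?_
  simp only [List.forall_mem_map]
  intro a ha
  have := h a ha
  omega

/-- A bound for the sizes of the hints of the checker, in terms of the number and the sizes of the
terms of the queries. -/
def hintBound (n : ℕ) : ℕ := 1 + n * (2 * n + 2)

theorem le_hintBound (n : ℕ) : n ≤ hintBound n := by
  unfold hintBound
  nlinarith

theorem IsMapping.exists_hint {n : ℕ} (h : IsMapping Q₁ Q₂ (knownFormulas L) σ)
    (hsize : ∀ t ∈ Q₁.terms ++ Q₂.terms, t.enc.size ≤ n) (hlen : Q₁.terms.length ≤ n) :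
    ∃ H, H.size ≤ hintBound n ∧ IsMappingCode (.pair Q₁.enc Q₂.enc) H L ∧
      Encodes H σ Q₁.terms := by
  obtain ⟨hsubst, hH⟩ := exists_isSubstCode h.terms
  refine ⟨_, ?_, (hH.isMappingCode_iff hsubst h.terms).2 h, hH⟩
  refine (size_encList_le (k := 2 * n + 1) fun s hs => ?_).trans ?_
  · have := hsize s (List.mem_append_left _ hs)
    have := hsize _ (h.terms s hs)
    simp only [size]
    omega
  · unfold hintBound
    gcongr

theorem IsMapping.mono {S S' : Set Formula} (h : IsMapping Q₁ Q₂ S σ) (hS : S ⊆ S') :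
    IsMapping Q₁ Q₂ S' σ where
  terms := h.terms
  head := h.head.imp fun _ _ e => ⟨hS e.1, hS e.2⟩
  body a ha := by
    obtain ⟨b, hb, hrel, hargs⟩ := h.body a ha
    exact ⟨b, hb, hrel, hargs.imp fun _ _ e => ⟨hS e.1, hS e.2⟩⟩

theorem Step.mono {S S' : Set Formula} (h : Step Q₁ Q₂ S f) (hS : S ⊆ S') : Step Q₁ Q₂ S' f := by
  cases h with
  | comparison hc hf => exact .comparison hc hf
  | const_le h => exact .const_le h
  | const_ne h => exact .const_ne h
  | refl a => exact .refl a
  | trans hab hbc => exact .trans (hS hab) (hS hbc)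
  | ne_between huw hau hub haw hwb =>
    exact .ne_between (hS huw) (hS hau) (hS hub) (hS haw) (hS hwb)
  | contradiction h => exact .contradiction (hS h)
  | mapping_bot hσ himage => exact .mapping_bot (hσ.mono hS) fun c hc g hg => hS (himage c hc g hg)
  | mapping_neg hσ hc hrsi himage hf =>
    exact .mapping_neg (hσ.mono hS) hc hrsi (fun c' hc' hne g hg => hS (himage c' hc' hne g hg)) hf

theorem Step.exists_isStep {n : ℕ} (h : Step Q₁ Q₂ (knownFormulas L) f)
    (hsize : ∀ t ∈ Q₁.terms ++ Q₂.terms, t.enc.size ≤ n) (hlen : Q₁.terms.length ≤ n)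
    (hterms : ∀ g ∈ knownFormulas L, ∀ t ∈ g.terms, t ∈ Q₁.terms ++ Q₂.terms) :
    ∃ H, H.size ≤ hintBound n ∧ IsStep (.pair Q₁.enc Q₂.enc) f.enc H L := by
  have no_hint : (Data.int 0).size ≤ hintBound n := by simp [hintBound]
  have size_left {a b : Term} {g : Formula} (hg : g ∈ knownFormulas L) (e : g.terms = [a, b]) :
      a.enc.size ≤ n :=
    hsize a (hterms g hg a (e ▸ List.mem_cons_self))
  have size_right {a b : Term} {g : Formula} (hg : g ∈ knownFormulas L) (e : g.terms = [a, b]) :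
      b.enc.size ≤ n :=
    hsize b (hterms g hg b (e ▸ List.mem_cons_of_mem a List.mem_cons_self))
  cases h with
  | comparison hc hf => exact ⟨_, no_hint, .inl (exists_comparison_iff.2 ⟨_, hc, hf⟩)⟩
  | @const_le c d hcd =>
    refine ⟨_, no_hint, .inr (.inl ⟨rfl, rfl, .inl ⟨rfl, ?_⟩⟩)⟩
    exact (ile_int _ _).2 ((Rat.le_iff c d).1 hcd)
  | const_ne hcd =>
    refine ⟨_, no_hint, .inr (.inl ⟨rfl, rfl, .inr ⟨rfl, fun e => hcd ?_⟩⟩)⟩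
    exact Term.const.inj (Term.enc_injective e)
  | refl a => exact ⟨_, no_hint, .inr (.inr (.inl (.inl ⟨rfl, .inl rfl⟩)))⟩
  | trans hab hbc =>
    exact ⟨_, (size_right hab rfl).trans (le_hintBound n),
      .inr (.inr (.inl (.inl ⟨rfl, .inr ⟨hab, hbc⟩⟩)))⟩
  | @ne_between a b u w huw hau hub haw hwb =>
    refine ⟨.pair u.enc w.enc, ?_, .inr (.inr (.inl (.inr ⟨rfl, huw, ⟨hau, hub⟩, haw, hwb⟩)))⟩
    have := size_left huw rfl
    have := size_right huw rfl
    simp only [size, hintBound]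
    nlinarith
  | contradiction h =>
    exact ⟨_, (size_left h rfl).trans (le_hintBound n), .inr (.inr (.inr (.inl ⟨rfl, h⟩)))⟩
  | mapping_bot hσ himage =>
    obtain ⟨H, hsize, hmap, hH⟩ := hσ.exists_hint hsize hlen
    refine ⟨H, hsize, .inr (.inr (.inr (.inr ⟨hmap, .inl ⟨rfl, ?_⟩⟩)))⟩
    exact forall_mem_elems_encList.2 fun c hc => (hH.imageKnown_iff hc).2 (himage c hc)
  | @mapping_neg σ c f hσ hc hrsi himage hf =>
    obtain ⟨H, hsize, hmap, hH⟩ := hσ.exists_hint hsize hlen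
    refine ⟨H, hsize, .inr (.inr (.inr (.inr ⟨hmap, .inr ?_⟩)))⟩
    refine exists_mem_elems_encList.2 ⟨c, hc, (hH.isNegImage_iff hc).2 ⟨hrsi, hf⟩, ?_⟩
    exact forall_mem_elems_encList.2 fun c' hc' hne => (hH.imageKnown_iff hc').2
      (himage c' hc' fun e => hne (e ▸ rfl))

end CheckerCorrectness

section Certificates

open Polynomial

variable {Q₁ Q₂ : Query}

theorem sum_map_flatMap_le_size_encList {α β : Type} {e : α → Data} {g : α → List β} {w : β → ℕ}
    (h : ∀ a, ((g a).map w).sum ≤ (e a).size) (l : List α) :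
    ((l.flatMap g).map w).sum ≤ (encList e l).size := by
  induction l with
  | nil => simp
  | cons a l ih =>
    have := h a
    simp only [List.flatMap_cons, List.map_append, List.sum_append, encList, size]
    omega

theorem sum_map_size_le_size_encList {α : Type} (e : α → Data) (l : List α) :
    (l.map fun a => (e a).size).sum ≤ (encList e l).size := by
  simpa only [List.flatMap_singleton'] using
    sum_map_flatMap_le_size_encList (g := fun a => [a]) (fun a => by simp) l

theorem Query.sum_size_terms_le (Q : Query) :
    (Q.terms.map fun t => t.enc.size).sum ≤ Q.enc.size := by
  have head := sum_map_size_le_size_encList Term.enc Q.head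
  have body := sum_map_flatMap_le_size_encList (e := Atom.enc) (g := Atom.args)
    (w := fun t => t.enc.size)
    (fun a => (sum_map_size_le_size_encList Term.enc a.args).trans (size_right_le a.enc)) Q.body
  have acs := sum_map_flatMap_le_size_encList (e := AC.enc) (g := fun c => [.var c.lhs, c.rhs])
    (w := fun t => t.enc.size) (fun c => by
      have := c.op.enc.one_le_size
      simp [Term.enc, AC.enc, size]
      omega) Q.acs
  simp only [Query.terms, List.map_append, List.sum_append, Query.enc, size]
  omega

theorem length_le_sum_size (T : List Term) : T.length ≤ (T.map fun t => t.enc.size).sum := by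
  simpa using List.card_nsmul_le_sum (T.map fun t => t.enc.size) 1
    (List.forall_mem_map.2 fun t _ => t.enc.one_le_size)

theorem sum_size_terms_le :
    ((Q₁.terms ++ Q₂.terms).map fun t => t.enc.size).sum ≤ (Data.pair Q₁.enc Q₂.enc).size := by
  have := Q₁.sum_size_terms_le
  have := Q₂.sum_size_terms_le
  simp only [List.map_append, List.sum_append, size]
  omega

theorem exists_finset_enc_mem {T : List Term} {n : ℕ} (hsize : ∀ t ∈ T, t.enc.size ≤ n)
    (hlen : T.length ≤ n) : ∃ U : Finset Data, U.card ≤ 1 + 2 * n ^ 2 ∧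
      (∀ f ∈ U, f.size ≤ 2 * n + 4) ∧
      ∀ φ : Formula, (∀ t ∈ φ.terms, t ∈ T) → φ.enc ∈ U := by
  let formulas : List Formula := .bot :: ((T ×ˢ T).map fun p => .le p.1 p.2) ++
    (T ×ˢ T).map fun p => .ne p.1 p.2
  refine ⟨(formulas.map Formula.enc).toFinset, ?_, ?_, ?_⟩
  · refine (List.toFinset_card_le _).trans ?_
    simp only [formulas, List.length_map, List.length_append, List.length_cons,
      List.length_product]
    nlinarith
  · simp only [formulas, List.mem_toFinset, List.forall_mem_map, List.forall_mem_append,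
      List.forall_mem_cons, List.mem_product, Prod.forall, Formula.enc, leCode, neCode, size,
      Int.natAbs_zero, Int.natAbs_one, Nat.size_zero, Nat.size_one]
    exact ⟨⟨by lia, fun a b h => by grind⟩, fun a b h => by grind⟩
  · intro φ hφ
    rw [List.mem_toFinset, List.mem_map_of_injective Formula.enc_injective]
    rcases φ with _ | ⟨a, b⟩ | ⟨a, b⟩
    all_goals simp_all [formulas, Formula.terms]

/-- The check that `f` follows from the list `L` of earlier conclusions with the hint `H`. -/
def IsCheckedStep (x f H L : Data) : Prop :=
  IsFormulaCode x f ∧ IsStep x f H L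

/-- A bound for the size of a saturated derivation for an instance of given size. -/
noncomputable def certificateBound : ℕ[X] :=
  1 + (1 + 2 * X ^ 2) * ((2 * X + 4) + (1 + X * (2 * X + 2)) + 2)

theorem derivable_of_known {C : Data} {f : Formula}
    (hC : IsDerivation (IsCheckedStep (.pair Q₁.enc Q₂.enc)) C) (hf : Known C f.enc) :
    Derivable Q₁ Q₂ f := by
  have derivable : ∀ g, Known C g → ∃ φ : Formula, φ.enc = g ∧ Derivable Q₁ Q₂ φ := by
    refine hC.forall_known fun g H L hg ih => ?_
    obtain ⟨φ, rfl, hφ⟩ := isFormulaCode_iff.1 hg.1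
    refine ⟨φ, rfl, .step (S := knownFormulas L) (fun ψ hψ => ?_) (hg.2.step fun g hg => ?_) hφ⟩
    · obtain ⟨ψ', e, h⟩ := ih _ hψ
      exact Formula.enc_injective e ▸ h
    · obtain ⟨ψ, e, -⟩ := ih g hg
      exact ⟨ψ, e⟩
  obtain ⟨φ, e, h⟩ := derivable _ hf
  exact Formula.enc_injective e ▸ h

theorem exists_derivation_of_derivable : ∃ C : Data,
    C.size ≤ certificateBound.eval (Data.pair Q₁.enc Q₂.enc).size ∧
      IsDerivation (IsCheckedStep (.pair Q₁.enc Q₂.enc)) C ∧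
      ∀ f : Formula, Derivable Q₁ Q₂ f → Known C f.enc := by
  set n := (Data.pair Q₁.enc Q₂.enc).size
  have hlen : (Q₁.terms ++ Q₂.terms).length ≤ n := (length_le_sum_size _).trans sum_size_terms_le
  have hsize : ∀ t ∈ Q₁.terms ++ Q₂.terms, t.enc.size ≤ n := fun t ht =>
    (List.single_le_sum (fun _ _ => Nat.zero_le _) _ (List.mem_map_of_mem ht)).trans
      sum_size_terms_le
  obtain ⟨U, hcard, hU, henc⟩ := exists_finset_enc_mem hsize hlen
  obtain ⟨C, hC, hCsize, hsat⟩ := exists_saturated_derivation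
    (IsCheckedStep (.pair Q₁.enc Q₂.enc)) hU (hintBound n)
  have hterms : ∀ g ∈ knownFormulas C, ∀ t ∈ g.terms, t ∈ Q₁.terms ++ Q₂.terms := by
    intro g hg
    obtain ⟨φ, e, hφ⟩ := isFormulaCode_iff.1
      (hC.forall_known (fun _ _ _ h _ => h.1) _ hg)
    exact Formula.enc_injective e ▸ hφ
  refine ⟨C, hCsize.trans ?_, hC, fun f hf => ?_⟩
  · simp only [certificateBound, hintBound, eval_add, eval_mul, eval_pow, eval_one, eval_X,
      eval_ofNat]
    gcongr
  · induction hf with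
    | @step S f _ hstep hf ih =>
      obtain ⟨H, hH, h⟩ := (hstep.mono (S' := knownFormulas C) ih).exists_isStep hsize
        ((List.length_append ▸ Nat.le_add_right _ _).trans hlen) hterms
      exact hsat _ (henc f hf) H hH ⟨isFormulaCode_iff.2 ⟨f, rfl, hf⟩, h⟩

theorem derivable_bot_iff_exists_derivation : Derivable Q₁ Q₂ .bot ↔ ∃ C : Data,
    C.size ≤ certificateBound.eval (Data.pair Q₁.enc Q₂.enc).size ∧
      IsDerivation (IsCheckedStep (.pair Q₁.enc Q₂.enc)) C ∧ Known C Formula.bot.enc := by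
  constructor
  · intro h
    obtain ⟨C, hsize, hC, hknown⟩ := exists_derivation_of_derivable (Q₁ := Q₁) (Q₂ := Q₂)
    exact ⟨C, hsize, hC, hknown _ h⟩
  · rintro ⟨C, -, hC, hbot⟩
    exact derivable_of_known hC hbot

theorem exists_NP_derivable_bot : ∃ L : Set Data, Machine.NP L ∧
    ∀ Q₁ Q₂ : Query, .pair Q₁.enc Q₂.enc ∈ L ↔ Derivable Q₁ Q₂ .bot := by
  have derivation : PolyTimePred fun w => IsDerivation (IsCheckedStep w.left) w.right :=
    .isDerivation (J := fun w => IsCheckedStep w.left)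
      (by unfold IsCheckedStep; fun_prop) (by fun_prop)
  obtain ⟨L, hL, h⟩ := exists_NP_of_certificates
    (P := fun x C => IsDerivation (IsCheckedStep x) C ∧ Known C Formula.bot.enc)
    (derivation.and (by fun_prop)) certificateBound
  exact ⟨L, hL, fun Q₁ Q₂ => (h _).trans derivable_bot_iff_exists_derivation.symm⟩

end Certificates

section MainTheorem

variable {D : Type*} [LinearOrder D] (ι : ℚ ↪o D)

/-- The containment problem for all pairs of queries that satisfy the side condition, the
comparisons of the safe query `Q₁` being LSIs, open or closed, and at most one RSI. -/
def semiIntervalContainment : DecisionProblem where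
  Inst := {P : Query × Query // P.1.IsSemiInterval ∧ (∀ e ∈ P.1.acs, P.1.OccursInBody e.lhs) ∧
    SideCondition ι P.1 P.2}
  enc P := .pair P.1.1.enc P.1.2.enc
  yes P := P.1.2.Contained ι P.1.1

theorem Query.InClass.isSemiInterval {l r : CompOp} {Q : Query} (h : Q.InClass l r)
    (hl : l = .le ∨ l = .lt) (hr : r = .ge ∨ r = .gt) : Q.IsSemiInterval where
  op e he := by grind [Query.InClass, AC.IsRSI]
  rhs_const e he := (h.1 e he).2
  rsi_unique e he e' he' := by grind [Query.InClass, AC.IsRSI]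

theorem containmentProblem_inNP_of_semiInterval {l r : CompOp} (hl : l = .le ∨ l = .lt)
    (hr : r = .ge ∨ r = .gt) (h : (semiIntervalContainment ι).InNP) :
    (containmentProblem ι l r).InNP :=
  h.of_embedding (fun P => ⟨P.1, P.2.2.2.1.isSemiInterval hl hr, P.2.1.lhs_safe, P.2.2.2.2⟩)
    (fun _ => rfl) fun _ => Iff.rfl

end MainTheorem

end CQAC

theorem mainTheorem9_general {D : Type*} [LinearOrder D] [DenselyOrdered D] [NoMinOrder D]
    [NoMaxOrder D] (ι : ℚ ↪o D) : (CQAC.semiIntervalContainment ι).InNP := by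
  obtain ⟨L, hL, h⟩ := CQAC.exists_NP_derivable_bot
  refine ⟨L, hL, fun ⟨P, hsemi, hsafe, hside⟩ => (h P.1 P.2).trans ?_⟩
  exact ⟨CQAC.contained_of_derivable_bot, CQAC.derivable_bot_of_contained hsemi hsafe hside⟩

theorem mainTheorem9 {D : Type*} [LinearOrder D] [DenselyOrdered D] [NoMinOrder D] [NoMaxOrder D]
    (ι : ℚ ↪o D) :
    (CQAC.containmentProblem ι .le .ge).InNP ∧
    (CQAC.containmentProblem ι .le .gt).InNP ∧
    (CQAC.containmentProblem ι .lt .ge).InNP ∧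
    (CQAC.containmentProblem ι .lt .gt).InNP := by
  have h := mainTheorem9_general ι
  exact ⟨CQAC.containmentProblem_inNP_of_semiInterval ι (.inl rfl) (.inl rfl) h,
    CQAC.containmentProblem_inNP_of_semiInterval ι (.inl rfl) (.inr rfl) h,
    CQAC.containmentProblem_inNP_of_semiInterval ι (.inr rfl) (.inl rfl) h,
    CQAC.containmentProblem_inNP_of_semiInterval ι (.inr rfl) (.inr rfl) h⟩
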